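/- **Setting.** Let $N,M\ge 0$, $\eta\in\mathbb C$ and $\xi_1,\dots,\xi_N\in\mathbb C$, and let $\mathcal H=(\mathbb C^2)^{\otimes N}$ with $|0\rangle$ the state with all spins up. Let $R(\lambda)=\lambda\,\mathrm{Id}+\eta P\in\mathrm{End}(\mathbb C^2\otimes\mathbb C^2)$, where $P$ is the permutation operator. With an auxiliary space $\mathcal H_0=\mathbb C^2$, put $$M_0(\lambda)=R_{0N}(\lambda-\xi_N-\tfrac{\eta}{2})\cdots R_{01}(\lambda-\xi_1-\tfrac{\eta}{2})=\begin{pmatrix}A(\lambda)&B(\lambda)\\ C(\lambda)&D(\lambda)\end{pmatrix},\qquad \hat M_0(\lambda)=(-1)^N\sigma_0^y\,M_0^{t_0}(-\lambda)\,\sigma_0^y,$$ and $d(\lambda)=\prod_{n=1}^N(\lambda-\xi_n-\eta/2)$. Let $\zeta_+,\kappa_\pm,\tau_\pm\in\mathbb C$ and $\epsilon_\pm\in\{1,-1\}$ with $\zeta_+\ne0$ and $1+4\kappa_+^2\neq 0$. Put $\bar\zeta_+=\epsilon_+\zeta_+/\sqrt{1+4\kappa_+^2}$, $$K_+(\lambda)=\frac1{\zeta_+}\begin{pmatrix}\zeta_++\lambda+\frac\eta2&2\kappa_+e^{\tau_+}(\lambda+\frac\eta2)\\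 2\kappa_+e^{-\tau_+}(\lambda+\frac\eta2)&\zeta_+-\lambda-\frac\eta2\end{pmatrix},\qquad W=\begin{pmatrix}1&\frac{-1+\epsilon_-\sqrt{1+4\kappa_-^2}}{2\kappa_-e^{-\tau_-}}\\ \frac{1-\epsilon_+\sqrt{1+4\kappa_+^2}}{2\kappa_+e^{\tau_+}}&1\end{pmatrix}.$$ A value $\kappa_\pm=0$ is allowed only if the corresponding sign $\epsilon_\pm$ is $+1$, and then the corresponding off-diagonal entry of $W$ is read as its limit $0$. Assume $\det W\ne0$. Let $\mathcal U_+(\lambda)$ be defined by $\mathcal U_+^{t_0}(\lambda)=M_0^{t_0}(\lambda)K_+^{t_0}(\lambda)\hat M_0^{t_0}(\lambda)$ and put $\Gamma_W=W^{\otimes N}$, acting on $\mathcal H$. Let $\bar{\mathcal B}_+(\lambda)$ be the upper right entry of $\bar{\mathcal U}_+(\lambda)=W_0\Gamma_W\,\mathcal U_+(\lambda)\,\Gamma_W^{-1}W_0^{-1}$, and let $\bar b_+(\lambda)$ be the upper right entry of $WK_+(\lambda)W^{-1}$. For a finite ordered family $(\lambda_j)$ with signs $\sigma_j=\pm1$ put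 $$H^{\mathcal B_+}_{\sigma}(\lambda)=\prod_{j}d(-\sigma_j\lambda_j)\,\frac{2\lambda_j+\eta}{2\lambda_j}\,\bigl(\lambda_j+\sigma_j(\bar\zeta_+-\tfrac{\eta}{2})\bigr)\prod_{r<s}\frac{\sigma_s\lambda_s+\sigma_r\lambda_r-\eta}{\sigma_s\lambda_s+\sigma_r\lambda_r}.$$ **Proposition (boundary-bulk decomposition of separate states).** Let $\lambda_1,\dots,\lambda_M\in\mathbb C$ be nonzero with $\lambda_i^2\neq\lambda_j^2$ for $i\ne j$. Then $$\prod_{j=1}^M\bar{\mathcal B}_+(\lambda_j)|0\rangle=(-1)^{NM}\sum_{\mathcal X\sqcup\mathcal Y=\{1,\dots,M\}}\ \sum_{\sigma\in\{\pm1\}^{\mathcal Y}}\ \prod_{i\in\mathcal X}\bar b_+(\lambda_i)d(\lambda_i)d(-\lambda_i)\prod_{i\in\mathcal X}\prod_{j\in\mathcal Y}\frac{\lambda_i^2-(\sigma_j\lambda_j-\eta)^2}{\lambda_i^2-\lambda_j^2}\ \frac{H^{\mathcal B_+}_{\sigma}(\lambda_{\mathcal Y})}{\bar\zeta_+^{\,|\mathcal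 Y|}}\ \prod_{j\in\mathcal Y}B(\sigma_j\lambda_j)|0\rangle ,$$ where $\lambda_{\mathcal Y}=(\lambda_j)_{j\in\mathcal Y}$, the first sum runs over all $2^M$ ordered pairs $(\mathcal X,\mathcal Y)$ of disjoint sets with union $\{1,\dots,M\}$, and products of operators are taken in increasing order of the indices. -/

import Mathlib

open Matrix

noncomputable section

namespace OpenXXX

/-- A configuration of `N` spins `1/2`; the value `0` is "up" and `1` is "down". -/
abbrev Conf (N : ℕ) : Type := Fin N → Fin 2

/-- The quantum space `ℋ = ⊗ₙ ℂ²`, in coordinates with respect to the spin basis. -/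
abbrev Space (N : ℕ) : Type := Conf N → ℂ

/-- `End ℋ`, in the spin basis. -/
abbrev Op (N : ℕ) : Type := Matrix (Conf N) (Conf N) ℂ

/-- `End (ℂ² ⊗ ℋ)`, as 2×2 matrices over the auxiliary space with entries in `End ℋ`. -/
abbrev AuxOp (N : ℕ) : Type := Matrix (Fin 2) (Fin 2) (Op N)

/-- The reference state `|0⟩`, all spins up. -/
def vac (N : ℕ) : Space N := Pi.single (fun _ => 0) 1

/-- A 2×2 matrix acting on the `n`-th factor of `ℋ`, and as the identity on the others. -/
def siteOp {N : ℕ} (n : Fin N) (m : Matrix (Fin 2) (Fin 2) ℂ) : Op N :=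
  fun s t => if ∀ k, k ≠ n → s k = t k then m (s n) (t n) else 0

/-- A 2×2 scalar matrix acting on the auxiliary space only. -/
def auxOp (N : ℕ) (m : Matrix (Fin 2) (Fin 2) ℂ) : AuxOp N :=
  m.map (algebraMap ℂ (Op N))

/-- The rational 6-vertex `R`-matrix, `λ` times the identity plus `η` times the permutation. -/
def Rmat (η l : ℂ) : Matrix (Fin 2 × Fin 2) (Fin 2 × Fin 2) ℂ :=
  fun p q => (if p = q then l else 0) + (if p = q.swap then η else 0)

/-- `R₀ₙ(λ)`, acting on the auxiliary space and on the site `n`. -/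
def Rsite {N : ℕ} (η l : ℂ) (n : Fin N) : AuxOp N :=
  fun i j => siteOp n (fun s t => Rmat η l (i, s) (j, t))

/-- Bulk monodromy matrix `M(λ) = R₀N(λ - ξ_N - η/2) ⋯ R₀₁(λ - ξ₁ - η/2)`. -/
def bulkMonodromy {N : ℕ} (η : ℂ) (ξ : Fin N → ℂ) (l : ℂ) : AuxOp N :=
  ((List.ofFn fun n => Rsite η (l - ξ n - η / 2) n).reverse).prod

/-- The bulk operator `B(λ)`, the upper right entry of `M(λ)`. -/
def bulkB {N : ℕ} (η : ℂ) (ξ : Fin N → ℂ) (l : ℂ) : Op N :=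
  bulkMonodromy η ξ l 0 1

/-- The Pauli matrix `σʸ`. -/
def pauliY : Matrix (Fin 2) (Fin 2) ℂ := !![0, -Complex.I; Complex.I, 0]

/-- `M̂(λ) = (-1)^N σ₀ʸ M^{t₀}(-λ) σ₀ʸ`; the transposition `t₀` is in the auxiliary space only. -/
def bulkMonodromyHat {N : ℕ} (η : ℂ) (ξ : Fin N → ℂ) (l : ℂ) : AuxOp N :=
  (-1) ^ N * (auxOp N pauliY * (bulkMonodromy η ξ (-l))ᵀ * auxOp N pauliY)

/-- `d(λ) = ∏ₙ (λ - ξₙ - η/2)`. -/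
def dFun {N : ℕ} (η : ℂ) (ξ : Fin N → ℂ) (l : ℂ) : ℂ :=
  ∏ n, (l - ξ n - η / 2)

/-- Parameters of one boundary field: `ζ, κ, τ`, and the sign `ε` chosen for the square root. -/
structure Boundary where
  ζ : ℂ
  κ : ℂ
  τ : ℂ
  ε : ℤˣ

namespace Boundary

/-- `ε √(1 + 4κ²)`. -/
def root (b : Boundary) : ℂ := ((b.ε : ℤ) : ℂ) * Complex.sqrt (1 + 4 * b.κ ^ 2)

/-- `ζ̄ = ε ζ / √(1 + 4κ²)`. -/
def ζbar (b : Boundary) : ℂ := ((b.ε : ℤ) : ℂ) * b.ζ / Complex.sqrt (1 + 4 * b.κ ^ 2)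

/-- The scalar boundary matrix `K(λ; ζ, κ, τ)`. -/
def K (b : Boundary) (l : ℂ) : Matrix (Fin 2) (Fin 2) ℂ :=
  (1 / b.ζ) • !![b.ζ + l, 2 * b.κ * Complex.exp b.τ * l;
                 2 * b.κ * Complex.exp (-b.τ) * l, b.ζ - l]

end Boundary

/-- `K₊(λ) = K(λ + η/2; ζ₊, κ₊, τ₊)`. -/
def Kplus (η : ℂ) (bp : Boundary) (l : ℂ) : Matrix (Fin 2) (Fin 2) ℂ :=
  bp.K (l + η / 2)

/-- The boundary monodromy matrix `𝒰₊(λ)`, the transpose in the auxiliary space of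
`𝒰₊^{t₀}(λ) = M^{t₀}(λ) K₊^{t₀}(λ) M̂^{t₀}(λ)`. -/
def Uplus {N : ℕ} (η : ℂ) (ξ : Fin N → ℂ) (bp : Boundary) (l : ℂ) : AuxOp N :=
  ((bulkMonodromy η ξ l)ᵀ * (auxOp N (Kplus η bp l))ᵀ * (bulkMonodromyHat η ξ l)ᵀ)ᵀ

/-- The matrix `W` that brings `K₋` and `K₊` to triangular form. -/
def W (bp bm : Boundary) : Matrix (Fin 2) (Fin 2) ℂ :=
  !![1, (-1 + bm.root) / (2 * bm.κ * Complex.exp (-bm.τ));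
     (1 - bp.root) / (2 * bp.κ * Complex.exp bp.τ), 1]

/-- `Γ_W = ⊗ₙ Wₙ`, acting on the quantum space. -/
def Γ (N : ℕ) (w : Matrix (Fin 2) (Fin 2) ℂ) : Op N :=
  fun s t => ∏ n, w (s n) (t n)

/-- `𝒰̄₊(λ) = W₀ Γ_W 𝒰₊(λ) Γ_W⁻¹ W₀⁻¹`. -/
def Ubar {N : ℕ} (η : ℂ) (ξ : Fin N → ℂ) (bp bm : Boundary) (l : ℂ) : AuxOp N :=
  auxOp N (W bp bm)
    * (Uplus η ξ bp l).map (fun x => Γ N (W bp bm) * x * (Γ N (W bp bm))⁻¹)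
    * auxOp N (W bp bm)⁻¹

/-- The boundary operator `ℬ̄₊(λ)`, the upper right entry of `𝒰̄₊(λ)`. -/
def Bbar {N : ℕ} (η : ℂ) (ξ : Fin N → ℂ) (bp bm : Boundary) (l : ℂ) : Op N :=
  Ubar η ξ bp bm l 0 1

/-- `b̄₊(λ)`, the upper right entry of `K̄₊(λ) = W K₊(λ) W⁻¹`. -/
def bbar (η : ℂ) (bp bm : Boundary) (l : ℂ) : ℂ :=
  (W bp bm * Kplus η bp l * (W bp bm)⁻¹) 0 1

/-- Product of a finite ordered family of operators, in increasing order of the indices. -/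
def orderedProd {N : ℕ} {ι : Type} [Fintype ι] [LinearOrder ι] (f : ι → Op N) : Op N :=
  (((Finset.univ : Finset ι).sort (· ≤ ·)).map f).prod

/-- A sign as a complex number. -/
def sgn (u : ℤˣ) : ℂ := ((u : ℤ) : ℂ)

/-- The coefficient `H_σ(λ)` for a finite ordered family of parameters `λ` and signs `σ`:
`∏ⱼ d(-σⱼλⱼ) (2λⱼ+η)/(2λⱼ) (λⱼ + σⱼ(ζ̄₊ - η/2))`
times `∏_{r<s} (σₛλₛ + σᵣλᵣ - η)/(σₛλₛ + σᵣλᵣ)`. -/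
def H {N : ℕ} (η : ℂ) (ξ : Fin N → ℂ) (bp : Boundary) {ι : Type} [Fintype ι] [LinearOrder ι]
    (σ : ι → ℤˣ) (l : ι → ℂ) : ℂ :=
  (∏ j, dFun η ξ (-(sgn (σ j) * l j)) * ((2 * l j + η) / (2 * l j))
      * (l j + sgn (σ j) * (bp.ζbar - η / 2)))
    * ∏ r, ∏ s, if r < s then
        (sgn (σ s) * l s + sgn (σ r) * l r - η) / (sgn (σ s) * l s + sgn (σ r) * l r)
      else 1

end OpenXXX

end

/-!
The similarity transformation by `W` costs nothing on the bulk side: the `R`-matrix commutes with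
`W ⊗ W`, so conjugation by `Γ_W` on the quantum space undoes conjugation by `W` on the auxiliary
space (`conjAux_bulkMonodromy`), and `𝒰̄₊` is `𝒰₊` with `K₊` replaced by `W K₊ W⁻¹` (`Ubar_eq`). The
second row of `W` is a left eigenvector of `K₊`, so `W K₊ W⁻¹` is upper triangular. With the
`RTT` relation this gives (`Bbar_mulVec`)
`(-1)^N ℬ̄₊(λ) = (2λ + η) (∑_{x = ±λ} h(x) B(x) D(-x) + c D(-λ) D(λ))`, where
`h(x) = (x + ζ̄₊ - η/2) / (2x ζ̄₊)` and `b̄₊(λ) = (2λ + η) c`.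

From here on only the exchange relations of `B` and `D` and the eigenvalue `d` of `D` on `|0⟩`
matter (`IsExchange`). The claim is proved by induction on the number of boundary operators. A
term of the expansion is a state `t`: each index is absent (it lies in `𝒳`) or carries one of
`±λ`. When `D(u)` acts on the expansion, it either passes all the `B`, or exchanges its argument
with one of them, which is thereby removed. The coefficients are such that a removed index
contributes a partial fraction (`stateCoef_update_some`), and all the ways to reach a given state
add up to the partial fraction expansion `poleSum` of `(∏ F(λᵢ, u) - 1) h(u) · 2u / (2u - η)`,
with `F(p, x) = (p² - (x - η)²) / (p² - x²)` and the product over the absent indices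
(`two_mul_sub_mul_poleSum`). In the coefficient `h(x) ∏ F` of a new parameter `x = ±λ`, the part
`h(x)` comes from the term in which `D` passes, and the part `h(x) (∏ F - 1)` from the exchanged
arguments in `D D`. The states that contain both `B(λ)` and `B(-λ)` cancel by `poleSum_erase_add`.
This is the induction step `IsExchange.bdyOp_sum_bulkState`.
-/

noncomputable section

namespace OpenXXX

/-! ### Partial fraction identities -/

/-- The two-point factor `(p² - (x - η)²) / (p² - x²)`, even in `p`. -/
def pairF (η p x : ℂ) : ℂ := (p ^ 2 - (x - η) ^ 2) / (p ^ 2 - x ^ 2)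

/-- The boundary weight `g (x + a) / (2x)` of a bulk parameter `x`. -/
def bdyWeight (g a x : ℂ) : ℂ := g * (x + a) / (2 * x)

/-- The sum over `k ∈ T` and over both signs of the partial fractions with poles at `w = ± l k`
of `g (∏ i ∈ T, pairF η (l i) w - 1) (w + a) / (2w - η)`; see `two_mul_sub_mul_poleSum`. -/
def poleSum {ι : Type*} [DecidableEq ι] (η g a : ℂ) (l : ι → ℂ) (T : Finset ι) (w : ℂ) : ℂ :=
  ∑ k ∈ T, ∑ ε : ℤˣ, η / (sgn ε * l k - w) * bdyWeight g a (sgn ε * l k)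
    * ∏ i ∈ T.erase k, pairF η (l i) (sgn ε * l k)

lemma sum_sgn {A : Type*} [AddCommMonoid A] (φ : ℤˣ → A) : ∑ ε, φ ε = φ 1 + φ (-1) := by
  rw [UnitsInt.univ]; rw [Finset.sum_pair (by decide)]

@[simp] lemma sgn_one : sgn 1 = 1 := by simp [sgn]
@[simp] lemma sgn_neg_one : sgn (-1) = -1 := by simp [sgn]

lemma sgn_eq (ε : ℤˣ) : sgn ε = 1 ∨ sgn ε = -1 := by
  rcases Int.units_eq_one_or ε with rfl | rfl <;> simp

lemma sgn_mul_sq (ε : ℤˣ) (x : ℂ) : (sgn ε * x) ^ 2 = x ^ 2 := by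
  rcases sgn_eq ε with h | h <;> simp [h]

lemma sgn_mul_ne_zero (ε : ℤˣ) {x : ℂ} (hx : x ≠ 0) : sgn ε * x ≠ 0 := by
  rcases sgn_eq ε with h | h <;> simp [h, hx]

lemma pairF_sgn (η p x : ℂ) (ε : ℤˣ) : pairF η (sgn ε * p) x = pairF η p x := by
  simp [pairF, sgn_mul_sq]

/-- The cancellation, for a single pole `y`, behind the induction in `two_mul_sub_mul_poleSum`:
both sides have the same partial fraction expansion in `t`. -/
lemma pairF_div_add (η t y w : ℂ) (ht : t ≠ 0) (hty : y ^ 2 ≠ t ^ 2) (htw : w ^ 2 ≠ t ^ 2)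
    (hyw : y ≠ w) :
    pairF η t y / (y - w) + (η * (2 * t - η) / ((t - w) * (2 * t) * (y - t))
      + η * (2 * (-t) - η) / ((-t - w) * (2 * (-t)) * (y - -t))) = pairF η t w / (y - w) := by
  have h1 : y - t ≠ 0 := fun h => hty (by rw [sub_eq_zero.1 h])
  have h2 : y - -t ≠ 0 := fun h => hty (by rw [sub_eq_zero.1 h]; ring)
  have h3 : t - w ≠ 0 := fun h => htw (by rw [sub_eq_zero.1 h])
  have h4 : -t - w ≠ 0 := fun h => htw (by rw [← sub_eq_zero.1 h]; ring)
  have h5 : y - w ≠ 0 := sub_ne_zero.2 hyw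
  have h6 : pairF η t y = (t ^ 2 - (y - η) ^ 2) / ((y - t) * -(y - -t)) := by
    rw [pairF]; congr 1; ring
  have h7 : pairF η t w = (t ^ 2 - (w - η) ^ 2) / ((t - w) * -(-t - w)) := by
    rw [pairF]; congr 1; ring
  rw [h6, h7]
  -- `y + t` and `-t - w` are kept as atoms, so that `field_simp` sees that they do not vanish
  generalize hA : y - -t = A at *
  generalize hB : -t - w = B at *
  field_simp
  subst hA hB
  ring

lemma sum_sgn_pole (η g a t w : ℂ) (ht : t ≠ 0) (htw : w ^ 2 ≠ t ^ 2) :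
    (2 * w - η) * ∑ ε : ℤˣ, η / (sgn ε * t - w) * bdyWeight g a (sgn ε * t)
      = g * (pairF η t w - 1) * (w + a) := by
  have h3 : t - w ≠ 0 := fun h => htw (by rw [sub_eq_zero.1 h])
  have h4 : -t - w ≠ 0 := fun h => htw (by rw [← sub_eq_zero.1 h]; ring)
  have h7 : pairF η t w = (t ^ 2 - (w - η) ^ 2) / ((t - w) * -(-t - w)) := by
    rw [pairF]; congr 1; ring
  rw [sum_sgn, h7]
  simp only [sgn_one, sgn_neg_one, one_mul, neg_one_mul, bdyWeight]
  generalize hB : -t - w = B at *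
  field_simp
  subst hB
  ring

/-- The partial fraction expansion of `g (∏ i ∈ T, pairF η (l i) w - 1) (w + a) / (2w - η)`. -/
lemma two_mul_sub_mul_poleSum {ι : Type*} [DecidableEq ι] (η g a : ℂ) (l : ι → ℂ) (T : Finset ι)
    (hl : ∀ i ∈ T, l i ≠ 0) (hll : ∀ i ∈ T, ∀ j ∈ T, i ≠ j → l i ^ 2 ≠ l j ^ 2) (w : ℂ)
    (hw : ∀ i ∈ T, w ^ 2 ≠ l i ^ 2) :
    (2 * w - η) * poleSum η g a l T w
      = g * (∏ i ∈ T, pairF η (l i) w - 1) * (w + a) := by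
  induction T using Finset.induction_on generalizing w with
  | empty => simp [poleSum]
  | insert t T htT ih =>
    have ih := ih (fun i hi => hl i (Finset.mem_insert_of_mem hi))
      (fun i hi j hj => hll i (Finset.mem_insert_of_mem hi) j (Finset.mem_insert_of_mem hj))
    have hne : ∀ k ∈ T, k ≠ t := fun k hk h => htT (h ▸ hk)
    have ht0 : l t ≠ 0 := hl t (Finset.mem_insert_self _ _)
    have htw : w ^ 2 ≠ l t ^ 2 := hw t (Finset.mem_insert_self _ _)
    have hw' : ∀ i ∈ T, w ^ 2 ≠ l i ^ 2 := fun i hi => hw i (Finset.mem_insert_of_mem hi)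
    -- the weight of a pole for `T`, without its denominator
    set q : ι → ℤˣ → ℂ := fun k ε => η * bdyWeight g a (sgn ε * l k)
      * ∏ i ∈ T.erase k, pairF η (l i) (sgn ε * l k) with hq
    have hS : ∀ z, poleSum η g a l T z = ∑ k ∈ T, ∑ ε, q k ε / (sgn ε * l k - z) := by
      intro z
      refine Finset.sum_congr rfl fun k _ => Finset.sum_congr rfl fun ε _ => ?_
      rw [hq]; ring
    have htT2 : ∀ ε : ℤˣ, ∀ i ∈ T, (sgn ε * l t) ^ 2 ≠ l i ^ 2 := by
      intro ε i hi
      rw [sgn_mul_sq]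
      exact hll t (Finset.mem_insert_self _ _) i (Finset.mem_insert_of_mem hi) (hne i hi).symm
    have hnew : ∀ ε : ℤˣ, η / (sgn ε * l t - w) * bdyWeight g a (sgn ε * l t)
          * ∏ i ∈ T, pairF η (l i) (sgn ε * l t)
        = η / (sgn ε * l t - w) * bdyWeight g a (sgn ε * l t)
          + η * (2 * (sgn ε * l t) - η) / ((sgn ε * l t - w) * (2 * (sgn ε * l t)))
            * poleSum η g a l T (sgn ε * l t) := by
      intro ε
      have h0 := sgn_mul_ne_zero ε ht0
      have := ih (sgn ε * l t) (htT2 ε)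
      have hw0 : sgn ε * l t - w ≠ 0 := fun h => htw (by rw [← sub_eq_zero.1 h, sgn_mul_sq])
      rw [bdyWeight]
      generalize sgn ε * l t = x at *
      field_simp
      linear_combination (-η) * this
    have hold : ∀ k ∈ T, ∀ ε : ℤˣ,
        η / (sgn ε * l k - w) * bdyWeight g a (sgn ε * l k)
            * ∏ i ∈ (insert t T).erase k, pairF η (l i) (sgn ε * l k)
          = q k ε * (pairF η (l t) (sgn ε * l k) / (sgn ε * l k - w)) := by
      intro k hk ε
      rw [Finset.erase_insert_of_ne (hne k hk).symm,
        Finset.prod_insert (fun h => htT (Finset.mem_of_mem_erase h)), hq]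
      ring
    have hsplit : poleSum η g a l (insert t T) w
        = ∑ ε : ℤˣ, η / (sgn ε * l t - w) * bdyWeight g a (sgn ε * l t)
          + pairF η (l t) w * poleSum η g a l T w := by
      rw [poleSum, Finset.sum_insert htT, Finset.erase_insert htT,
        Finset.sum_congr rfl fun ε _ => hnew ε, Finset.sum_add_distrib, add_assoc]
      congr 1
      rw [Finset.sum_congr rfl fun k hk => Finset.sum_congr rfl fun ε _ => hold k hk ε]
      simp only [hS]
      simp only [Finset.mul_sum]
      rw [Finset.sum_comm, ← Finset.sum_add_distrib]
      refine Finset.sum_congr rfl fun k hk => ?_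
      rw [Finset.sum_comm, ← Finset.sum_add_distrib]
      refine Finset.sum_congr rfl fun δ _ => ?_
      have hk2 : (sgn δ * l k) ^ 2 ≠ l t ^ 2 := by
        rw [sgn_mul_sq]
        exact hll k (Finset.mem_insert_of_mem hk) t (Finset.mem_insert_self _ _) (hne k hk)
      have hkw : sgn δ * l k ≠ w := fun h => hw' k hk (by rw [← h, sgn_mul_sq])
      have := pairF_div_add η (l t) (sgn δ * l k) w ht0 hk2 htw hkw
      rw [sum_sgn]
      simp only [sgn_one, sgn_neg_one, one_mul, neg_one_mul]
      simp only [div_eq_mul_inv, mul_inv] at this ⊢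
      linear_combination (q k δ) * this
    rw [hsplit, mul_add, sum_sgn_pole η g a _ _ ht0 htw, Finset.prod_insert htT]
    linear_combination (pairF η (l t) w) * ih w hw'

/-- `poleSum_erase_add` away from finitely many `v`, where it follows from
`two_mul_sub_mul_poleSum` at the points `v`, `-v` and `η - v`. -/
lemma poleSum_erase_add_of_ne {ι : Type*} [DecidableEq ι] (η g a : ℂ) (l : ι → ℂ) (T : Finset ι)
    (hl : ∀ i ∈ T, l i ≠ 0) (hll : ∀ i ∈ T, ∀ j ∈ T, i ≠ j → l i ^ 2 ≠ l j ^ 2) (v : ℂ)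
    (hv : v ≠ 0) (hvl : ∀ i ∈ T, v ^ 2 ≠ l i ^ 2) (hη : 2 * v - η ≠ 0)
    (hvη : ∀ i ∈ T, (η - v) ^ 2 ≠ l i ^ 2) :
    ∑ k ∈ T, ∑ ε : ℤˣ, poleSum η g a l (T.erase k) v *
        (η * ((sgn ε * l k - v + η) / ((sgn ε * l k - v) * (sgn ε * l k + v)))
          * bdyWeight g a (sgn ε * l k) * ∏ i ∈ T.erase k, pairF η (l i) (sgn ε * l k))
      + bdyWeight g a v * poleSum η g a l T (-v) + bdyWeight g a (-v) * poleSum η g a l T v = 0 := by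
  set P := ∏ i ∈ T, pairF η (l i) v with hP
  have hterm : ∀ k ∈ T, ∀ ε : ℤˣ, poleSum η g a l (T.erase k) v *
        (η * ((sgn ε * l k - v + η) / ((sgn ε * l k - v) * (sgn ε * l k + v)))
          * bdyWeight g a (sgn ε * l k) * ∏ i ∈ T.erase k, pairF η (l i) (sgn ε * l k))
      = g * (v + a) / (2 * v - η) *
        (P * (η / (sgn ε * l k - (η - v)) * bdyWeight g a (sgn ε * l k)
            * ∏ i ∈ T.erase k, pairF η (l i) (sgn ε * l k))
          - η / (2 * v) * (η / (sgn ε * l k - v) * bdyWeight g a (sgn ε * l k)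
            * ∏ i ∈ T.erase k, pairF η (l i) (sgn ε * l k))
          - (2 * v - η) / (2 * v) * (η / (sgn ε * l k - -v) * bdyWeight g a (sgn ε * l k)
            * ∏ i ∈ T.erase k, pairF η (l i) (sgn ε * l k))) := by
    intro k hk ε
    have hS := two_mul_sub_mul_poleSum η g a l (T.erase k)
      (fun i hi => hl i (Finset.mem_of_mem_erase hi))
      (fun i hi j hj => hll i (Finset.mem_of_mem_erase hi) j (Finset.mem_of_mem_erase hj)) v
      (fun i hi => hvl i (Finset.mem_of_mem_erase hi))
    have hPk : P = pairF η (l k) v * ∏ i ∈ T.erase k, pairF η (l i) v :=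
      (Finset.mul_prod_erase T _ hk).symm
    have hx2 := sgn_mul_sq ε (l k)
    have hF : pairF η (l k) v = pairF η (sgn ε * l k) v := (pairF_sgn _ _ _ _).symm
    have h1 : sgn ε * l k - v ≠ 0 := fun h => hvl k hk (by rw [← hx2, sub_eq_zero.1 h])
    have h2 : sgn ε * l k + v ≠ 0 := fun h => hvl k hk (by
      rw [← hx2, eq_neg_of_add_eq_zero_left h]; ring)
    have h3 : sgn ε * l k - (η - v) ≠ 0 := fun h => hvη k hk (by rw [← hx2, sub_eq_zero.1 h])
    rw [hF] at hPk
    generalize ∏ i ∈ T.erase k, pairF η (l i) v = Q at *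
    generalize ∏ i ∈ T.erase k, pairF η (l i) (sgn ε * l k) = R at *
    generalize bdyWeight g a (sgn ε * l k) = b at *
    generalize sgn ε * l k = x at *
    have hF2 : pairF η x v = (x - v + η) * (x - (η - v)) / ((x - v) * (x + v)) := by
      rw [pairF]; congr 1 <;> ring
    rw [hF2] at hPk
    have hS' : poleSum η g a l (T.erase k) v = g * (Q - 1) * (v + a) / (2 * v - η) := by
      rw [eq_div_iff hη, ← hS]; ring
    rw [hS', hPk, sub_neg_eq_add]
    generalize x - (η - v) = y at *
    field_simp
    ring
  rw [Finset.sum_congr rfl fun k hk => Finset.sum_congr rfl fun ε _ => hterm k hk ε]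
  simp only [← Finset.mul_sum, Finset.sum_sub_distrib]
  change g * (v + a) / (2 * v - η) * (P * poleSum η g a l T (η - v)
    - η / (2 * v) * poleSum η g a l T v - (2 * v - η) / (2 * v) * poleSum η g a l T (-v)) + _ + _ = _
  have e1 := two_mul_sub_mul_poleSum η g a l T hl hll v hvl
  have e2 := two_mul_sub_mul_poleSum η g a l T hl hll (η - v) hvη
  have hinv : P * ∏ i ∈ T, pairF η (l i) (η - v) = 1 := by
    rw [hP, ← Finset.prod_mul_distrib]
    refine Finset.prod_eq_one fun i hi => ?_
    have h1 := sub_ne_zero.2 (hvl i hi).symm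
    have h2 := sub_ne_zero.2 (hvη i hi).symm
    rw [pairF, pairF, show (v - η) ^ 2 = (η - v) ^ 2 by ring, show η - v - η = -v by ring,
      neg_sq]
    field_simp
  have e3 : P * poleSum η g a l T (η - v) = g * (P - 1) * (η - v + a) / (2 * v - η) := by
    rw [eq_div_iff hη]
    linear_combination (-P) * e2 - g * (η - v + a) * hinv
  have e4 : poleSum η g a l T v = g * (P - 1) * (v + a) / (2 * v - η) := by
    rw [eq_div_iff hη]; linear_combination e1
  rw [e3, e4, bdyWeight, bdyWeight]
  generalize hE : 2 * v - η = E at *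
  field_simp
  subst hE
  ring

/-- The identity behind the cancellation of the states that contain both `B v` and `B (-v)`. -/
lemma poleSum_erase_add {ι : Type*} [DecidableEq ι] (η g a : ℂ) (l : ι → ℂ) (T : Finset ι)
    (hl : ∀ i ∈ T, l i ≠ 0) (hll : ∀ i ∈ T, ∀ j ∈ T, i ≠ j → l i ^ 2 ≠ l j ^ 2) (v : ℂ)
    (hv : v ≠ 0) (hvl : ∀ i ∈ T, v ^ 2 ≠ l i ^ 2) :
    ∑ k ∈ T, ∑ ε : ℤˣ, poleSum η g a l (T.erase k) v *
        (η * ((sgn ε * l k - v + η) / ((sgn ε * l k - v) * (sgn ε * l k + v)))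
          * bdyWeight g a (sgn ε * l k) * ∏ i ∈ T.erase k, pairF η (l i) (sgn ε * l k))
      + bdyWeight g a v * poleSum η g a l T (-v) + bdyWeight g a (-v) * poleSum η g a l T v = 0 := by
  -- both sides are continuous at `v`, and they agree on a punctured neighbourhood
  have hx1 : ∀ k ∈ T, ∀ ε : ℤˣ, sgn ε * l k - v ≠ 0 := fun k hk ε h =>
    hvl k hk (by rw [← sgn_mul_sq ε (l k), sub_eq_zero.1 h])
  have hx2 : ∀ k ∈ T, ∀ ε : ℤˣ, sgn ε * l k + v ≠ 0 := fun k hk ε h =>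
    hvl k hk (by rw [← sgn_mul_sq ε (l k), eq_neg_of_add_eq_zero_left h]; ring)
  have hS : ∀ U ⊆ T, ContinuousAt (fun v => poleSum η g a l U v) v := by
    intro U hU
    refine tendsto_finsetSum _ fun k hk => tendsto_finsetSum _ fun ε _ => ?_
    exact ((continuousAt_const.div (by fun_prop) (hx1 k (hU hk) ε)).mul
      continuousAt_const).mul continuousAt_const
  have hS' : ContinuousAt (fun v => poleSum η g a l T (-v)) v := by
    refine tendsto_finsetSum _ fun k hk => tendsto_finsetSum _ fun ε _ => ?_
    refine ((continuousAt_const.div (by fun_prop) ?_).mul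
      continuousAt_const).mul continuousAt_const
    rw [sub_neg_eq_add]; exact hx2 k hk ε
  have hb : ContinuousAt (fun v => bdyWeight g a v) v :=
    ContinuousAt.div (by fun_prop) (by fun_prop) (by simpa using hv)
  have hb' : ContinuousAt (fun v => bdyWeight g a (-v)) v :=
    ContinuousAt.div (by fun_prop) (by fun_prop) (by simpa using hv)
  have hcont : ContinuousAt (fun v => ∑ k ∈ T, ∑ ε : ℤˣ, poleSum η g a l (T.erase k) v *
        (η * ((sgn ε * l k - v + η) / ((sgn ε * l k - v) * (sgn ε * l k + v)))
          * bdyWeight g a (sgn ε * l k) * ∏ i ∈ T.erase k, pairF η (l i) (sgn ε * l k))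
      + bdyWeight g a v * poleSum η g a l T (-v) + bdyWeight g a (-v) * poleSum η g a l T v) v := by
    refine (ContinuousAt.add ?_ (hb.mul hS')).add (hb'.mul (hS T subset_rfl))
    refine tendsto_finsetSum _ fun k hk => tendsto_finsetSum _ fun ε _ => ?_
    refine (hS _ (Finset.erase_subset _ _)).mul (((continuousAt_const.mul
      (ContinuousAt.div (by fun_prop) (by fun_prop) ?_)).mul
      continuousAt_const).mul continuousAt_const)
    exact mul_ne_zero (hx1 k hk ε) (hx2 k hk ε)
  have hne : ∀ c : ℂ, ∀ᶠ w in nhdsWithin v {v}ᶜ, w ≠ c := fun c => by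
    have := (Set.finite_singleton c).isClosed.isOpen_compl
    by_cases h : c = v
    · subst h; exact self_mem_nhdsWithin
    · exact mem_nhdsWithin_of_mem_nhds (this.mem_nhds fun h' => h h'.symm)
  have hev : ∀ᶠ w in nhdsWithin v {v}ᶜ, w ≠ 0 ∧ w ≠ η / 2 ∧ ∀ i ∈ T,
      w ≠ l i ∧ w ≠ -l i ∧ w ≠ η - l i ∧ w ≠ η + l i :=
    (hne _).and ((hne _).and ((Filter.eventually_all_finset T).2 fun i _ =>
      (hne _).and ((hne _).and ((hne _).and (hne _)))))
  refine tendsto_nhds_unique (hcont.tendsto.mono_left (nhdsWithin_le_nhds (s := {v}ᶜ)))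
    (tendsto_const_nhds.congr' ?_)
  filter_upwards [hev] with w ⟨h0, h1, h2⟩
  refine (poleSum_erase_add_of_ne η g a l T hl hll w h0 ?_ ?_ ?_).symm
  · intro i hi h
    rcases sq_eq_sq_iff_eq_or_eq_neg.1 h with h | h
    exacts [(h2 i hi).1 h, (h2 i hi).2.1 h]
  · intro h
    exact h1 (by linear_combination h / 2)
  · intro i hi h
    rcases sq_eq_sq_iff_eq_or_eq_neg.1 h with h | h
    · exact (h2 i hi).2.2.1 (by linear_combination -h)
    · exact (h2 i hi).2.2.2 (by linear_combination -h)

/-! ### Bulk states and the action of `D` -/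

/-- The part of the Yang–Baxter algebra that the argument uses, in the form of exchange relations
between the creation operators `B` and the operators `D`, together with the eigenvalue `d` of `D`
on the reference vector `v₀`. -/
structure IsExchange {V : Type*} [AddCommGroup V] [Module ℂ V] (η : ℂ) (B D : ℂ → V →ₗ[ℂ] V)
    (d : ℂ → ℂ) (v₀ : V) : Prop where
  comm : ∀ x y v, B x (B y v) = B y (B x v)
  exchange : ∀ x y v, x ≠ y →
    D x (B y v) = ((x - y + η) / (x - y)) • B y (D x v) - (η / (x - y)) • B x (D y v)
  vac : ∀ x, D x v₀ = d x • v₀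

/-- The product of the `B x` over the entries `some x` of `p`, applied to `v₀`. The entries `none`
are skipped, which allows a variable to be removed from a product without reindexing the others. -/
def bulkState {V : Type*} [AddCommGroup V] [Module ℂ V] (B : ℂ → V →ₗ[ℂ] V) (v₀ : V) {n : ℕ}
    (p : Fin n → Option ℂ) : V :=
  (List.ofFn p).foldr (fun o v => o.elim v fun x => B x v) v₀

/-- The factor `(u - x + η) / (u - x)` that `D u` acquires when it passes `B x`. -/
def exch (η u : ℂ) (o : Option ℂ) : ℂ := o.elim 1 fun x => (u - x + η) / (u - x)

section
variable {V : Type*} [AddCommGroup V] [Module ℂ V] {η : ℂ} {B D : ℂ → V →ₗ[ℂ] V} {d : ℂ → ℂ}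
  {v₀ : V}

lemma bulkState_cons {n : ℕ} (o : Option ℂ) (p : Fin n → Option ℂ) :
    bulkState B v₀ (Fin.cons o p : Fin (n + 1) → Option ℂ)
      = o.elim (bulkState B v₀ p) fun x => B x (bulkState B v₀ p) := by
  simp [bulkState, List.ofFn_succ]

/-- The action of `D u` on a bulk state: either `D u` passes all the `B x`, or it exchanges its
argument with exactly one of them. -/
lemma IsExchange.D_bulkState (h : IsExchange η B D d v₀) {n : ℕ} (p : Fin n → Option ℂ)
    (hp : ∀ i j x, i ≠ j → p i = some x → p j ≠ some x) (u : ℂ) (hu : ∀ j, p j ≠ some u) :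
    D u (bulkState B v₀ p) = (d u * ∏ j, exch η u (p j)) • bulkState B v₀ p
      + ∑ k, (p k).elim 0 fun y =>
        (η / (y - u) * d y * ∏ j, exch η y (Function.update p k none j))
          • B u (bulkState B v₀ (Function.update p k none)) := by
  induction n generalizing u with
  | zero => simp [bulkState, h.vac]
  | succ n ih =>
    induction p using Fin.consCases with
    | _ o p =>
    have hp' : ∀ i j x, i ≠ j → p i = some x → p j ≠ some x := fun i j x hij => by
      simpa using hp i.succ j.succ x (by simpa using hij)
    have hu' : ∀ j, p j ≠ some u := fun j => by simpa using hu j.succ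
    have ihu := ih p hp' u hu'
    simp only [Fin.sum_univ_succ, Fin.prod_univ_succ, Fin.cons_zero, Fin.cons_succ,
      ← Fin.cons_update, Fin.update_cons_zero, bulkState_cons]
    cases o with
    | none => simpa [exch] using ihu
    | some y =>
      have huy : u ≠ y := fun e => hu 0 (by simp [e])
      have hy' : ∀ j, p j ≠ some y := fun j => by
        simpa using hp 0 j.succ y (by simp [Fin.ext_iff]) (by simp)
      have ihy := ih p hp' y hy'
      simp only [Option.elim_some, Option.elim_none]
      rw [h.exchange u y _ huy, ihu, ihy]
      simp only [map_add, map_smul, map_sum, smul_add, Finset.smul_sum, smul_smul]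
      have hsum : ∑ x, ((u - y + η) / (u - y)) • B y ((p x).elim 0 fun z =>
              (η / (z - u) * d z * ∏ j, exch η z (Function.update p x none j))
                • B u (bulkState B v₀ (Function.update p x none)))
            - ∑ x, (η / (u - y)) • B u ((p x).elim 0 fun z =>
              (η / (z - y) * d z * ∏ j, exch η z (Function.update p x none j))
                • B y (bulkState B v₀ (Function.update p x none)))
          = ∑ x, (p x).elim 0 fun z =>
            (η / (z - u) * d z * (exch η z (some y)
                * ∏ j, exch η z (Function.update p x none j)))
              • B u (B y (bulkState B v₀ (Function.update p x none))) := by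
        rw [← Finset.sum_sub_distrib]
        refine Finset.sum_congr rfl fun x _ => ?_
        cases hx : p x with
        | none => simp
        | some z =>
          have h1 : z - u ≠ 0 := sub_ne_zero.2 fun e => hu' x (by rw [hx, e])
          have h2 : z - y ≠ 0 := sub_ne_zero.2 fun e => hy' x (by rw [hx, e])
          have h3 : u - y ≠ 0 := sub_ne_zero.2 huy
          simp only [Option.elim_some, map_smul, smul_smul]
          rw [h.comm y u, ← sub_smul]
          congr 1
          simp only [exch, Option.elim_some]
          field_simp
          ring
      have h3 : u - y ≠ 0 := sub_ne_zero.2 huy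
      have h4 : y - u ≠ 0 := sub_ne_zero.2 huy.symm
      rw [← hsum]
      have e1 : (u - y + η) / (u - y) * (d u * ∏ j, exch η u (p j))
          = d u * (exch η u (some y) * ∏ j, exch η u (p j)) := by
        simp only [exch, Option.elim_some]; ring
      have e2 : η / (y - u) * d y * (exch η y none * ∏ j, exch η y (p j))
          = -(η / (u - y) * (d y * ∏ j, exch η y (p j))) := by
        rw [← neg_sub u y, div_neg, exch, Option.elim_none]; ring
      rw [e1, e2, neg_smul]
      abel

end

/-! ### The expansion coefficients -/

/-- The bulk parameters of a state: each index `i` is absent or carries one of `± l i`. -/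
def points {n : ℕ} (l : Fin n → ℂ) (t : Fin n → Option ℤˣ) : Fin n → Option ℂ :=
  fun i => (t i).map fun ε => sgn ε * l i

/-- The indices that carry no bulk parameter. -/
def absent {n : ℕ} (t : Fin n → Option ℤˣ) : Finset (Fin n) :=
  Finset.univ.filter fun i => t i = none

/-- The one-index factor of an expansion coefficient. -/
def siteWt (d : ℂ → ℂ) (g a p : ℂ) (o : Option ℤˣ) : ℂ :=
  o.elim (d p * d (-p)) fun ε => d (-(sgn ε * p)) * bdyWeight g a (sgn ε * p)

/-- The two-index factor of an expansion coefficient. -/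
def pairWt (η p q : ℂ) : Option ℤˣ → Option ℤˣ → ℂ
  | none, none => 1
  | none, some δ => pairF η p (sgn δ * q)
  | some ε, none => pairF η q (sgn ε * p)
  | some ε, some δ => (sgn δ * q + sgn ε * p - η) / (sgn δ * q + sgn ε * p)

/-- The expansion coefficient of the product of boundary operators on the bulk state `t`, up to
the powers of the coefficient of `D D`. -/
def stateCoef (η : ℂ) (d : ℂ → ℂ) (g a : ℂ) {n : ℕ} (l : Fin n → ℂ) (t : Fin n → Option ℤˣ) : ℂ :=
  (∏ i, siteWt d g a (l i) (t i)) * ∏ i, ∏ j, if i < j then pairWt η (l i) (l j) (t i) (t j) else 1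

lemma pairWt_symm (η p q : ℂ) (o o' : Option ℤˣ) : pairWt η p q o o' = pairWt η q p o' o := by
  cases o <;> cases o' <;> simp [pairWt, add_comm]

/-- A product over pairs of a symmetric weight, with the pairs that contain `k` split off. -/
lemma prod_lt_eq_mul {n : ℕ} (w : Fin n → Fin n → ℂ) (hw : ∀ i j, w i j = w j i) (k : Fin n) :
    ∏ i, ∏ j, (if i < j then w i j else 1)
      = (∏ j ∈ Finset.univ.erase k, w k j)
        * ∏ i ∈ Finset.univ.erase k, ∏ j ∈ Finset.univ.erase k, if i < j then w i j else 1 := by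
  rw [← Finset.mul_prod_erase _ _ (Finset.mem_univ k),
    ← Finset.mul_prod_erase _ _ (Finset.mem_univ k)]
  have : ∀ i, ∏ j, (if i < j then w i j else 1) = (if i < k then w i k else 1)
      * ∏ j ∈ Finset.univ.erase k, if i < j then w i j else 1 := fun i =>
    (Finset.mul_prod_erase _ _ (Finset.mem_univ k)).symm
  rw [Finset.prod_congr rfl fun i _ => this i, Finset.prod_mul_distrib, if_neg (lt_irrefl k),
    one_mul, ← mul_assoc, ← Finset.prod_mul_distrib]
  congr 1
  refine Finset.prod_congr rfl fun j hj => ?_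
  rcases lt_or_gt_of_ne (Finset.ne_of_mem_erase hj) with h | h
  · rw [if_neg h.not_gt, if_pos h, one_mul, hw]
  · rw [if_pos h, if_neg h.not_gt, mul_one]

lemma absent_update_some {n : ℕ} (t : Fin n → Option ℤˣ) (k : Fin n) (ε : ℤˣ) :
    absent (Function.update t k (some ε)) = (absent t).erase k := by
  ext i
  by_cases h : i = k
  · subst h; simp [absent]
  · simp [absent, h]

lemma points_update {n : ℕ} (l : Fin n → ℂ) (t : Fin n → Option ℤˣ) (k : Fin n) :
    Function.update (points l t) k none = points l (Function.update t k none) := by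
  ext1 i
  by_cases h : i = k
  · subst h; simp [points]
  · simp [points, h]

/-- Exchanging the roles of an absent index `k` and of the bulk parameter `x = ± l k` in an
expansion coefficient. -/
lemma stateCoef_update_some (η : ℂ) (d : ℂ → ℂ) (g a : ℂ) {n : ℕ} (l : Fin n → ℂ)
    (hll : ∀ i j, i ≠ j → l i ^ 2 ≠ l j ^ 2) (t : Fin n → Option ℤˣ) (k : Fin n) (hk : t k = none)
    (ε : ℤˣ) :
    stateCoef η d g a l (Function.update t k (some ε))
        * (d (sgn ε * l k) * ∏ j, exch η (sgn ε * l k) (points l t j))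
      = stateCoef η d g a l t * (bdyWeight g a (sgn ε * l k)
        * ∏ i ∈ (absent t).erase k, pairF η (l i) (sgn ε * l k)) := by
  have hsplit : ∀ s : Fin n → Option ℤˣ, stateCoef η d g a l s
      = siteWt d g a (l k) (s k) * (∏ j ∈ Finset.univ.erase k, pairWt η (l k) (l j) (s k) (s j))
        * ((∏ i ∈ Finset.univ.erase k, siteWt d g a (l i) (s i))
          * ∏ i ∈ Finset.univ.erase k, ∏ j ∈ Finset.univ.erase k,
            if i < j then pairWt η (l i) (l j) (s i) (s j) else 1) := fun s => by
    rw [stateCoef, prod_lt_eq_mul (fun i j => pairWt η (l i) (l j) (s i) (s j))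
      (fun i j => pairWt_symm _ _ _ _ _) k, ← Finset.mul_prod_erase _ _ (Finset.mem_univ k)]
    ring
  have hne : ∀ i ∈ Finset.univ.erase k, Function.update t k (some ε) i = t i := fun i hi =>
    Function.update_of_ne (Finset.ne_of_mem_erase hi) _ _
  have hrest : (∏ i ∈ Finset.univ.erase k, siteWt d g a (l i) (Function.update t k (some ε) i))
          * ∏ i ∈ Finset.univ.erase k, ∏ j ∈ Finset.univ.erase k,
            (if i < j then pairWt η (l i) (l j) (Function.update t k (some ε) i)
              (Function.update t k (some ε) j) else 1)
      = (∏ i ∈ Finset.univ.erase k, siteWt d g a (l i) (t i))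
          * ∏ i ∈ Finset.univ.erase k, ∏ j ∈ Finset.univ.erase k,
            if i < j then pairWt η (l i) (l j) (t i) (t j) else 1 := by
    congr 1
    · exact Finset.prod_congr rfl fun i hi => by rw [hne i hi]
    · exact Finset.prod_congr rfl fun i hi => Finset.prod_congr rfl fun j hj => by
        rw [hne i hi, hne j hj]
  rw [hsplit, hsplit t, hrest, hk, Function.update_self]
  have hexch : ∏ j, exch η (sgn ε * l k) (points l t j)
      = ∏ j ∈ Finset.univ.erase k, exch η (sgn ε * l k) (points l t j) := by
    rw [← Finset.mul_prod_erase _ _ (Finset.mem_univ k)]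
    simp [points, hk, exch]
  have habs : ∏ i ∈ (absent t).erase k, pairF η (l i) (sgn ε * l k)
      = ∏ j ∈ Finset.univ.erase k, if t j = none then pairF η (l j) (sgn ε * l k) else 1 := by
    rw [← Finset.prod_filter]
    refine Finset.prod_congr ?_ fun _ _ => rfl
    ext i; simp [absent, and_comm]
  have hpair : (∏ j ∈ Finset.univ.erase k,
        pairWt η (l k) (l j) (some ε) (Function.update t k (some ε) j))
          * ∏ j ∈ Finset.univ.erase k, exch η (sgn ε * l k) (points l t j)
      = (∏ j ∈ Finset.univ.erase k, pairWt η (l k) (l j) none (t j))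
          * ∏ j ∈ Finset.univ.erase k, if t j = none then pairF η (l j) (sgn ε * l k) else 1 := by
    rw [← Finset.prod_mul_distrib, ← Finset.prod_mul_distrib]
    refine Finset.prod_congr rfl fun j hj => ?_
    rw [hne j hj]
    cases ht : t j with
    | none => simp [pairWt, points, ht, exch]
    | some δ =>
      have hsq : (sgn ε * l k) ^ 2 ≠ (sgn δ * l j) ^ 2 := by
        rw [sgn_mul_sq, sgn_mul_sq]
        exact hll k j (Finset.ne_of_mem_erase hj).symm
      simp only [pairWt, points, ht, exch, Option.map_some, Option.elim_some, reduceCtorEq,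
        if_false, mul_one]
      rw [← pairF_sgn η (l k) _ ε, pairF]
      generalize sgn ε * l k = x at *
      generalize sgn δ * l j = y at *
      rw [div_mul_div_comm]
      congr 1 <;> ring
  have hsite : siteWt d g a (l k) (some ε) * d (sgn ε * l k)
      = siteWt d g a (l k) none * bdyWeight g a (sgn ε * l k) := by
    simp only [siteWt, Option.elim_some, Option.elim_none]
    rcases sgn_eq ε with h | h <;> simp [h] <;> ring
  rw [hexch, habs]
  generalize (∏ i ∈ Finset.univ.erase k, siteWt d g a (l i) (t i))
          * ∏ i ∈ Finset.univ.erase k, ∏ j ∈ Finset.univ.erase k,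
            (if i < j then pairWt η (l i) (l j) (t i) (t j) else 1) = R at *
  generalize (∏ j ∈ Finset.univ.erase k,
        pairWt η (l k) (l j) (some ε) (Function.update t k (some ε) j)) = P1 at *
  generalize (∏ j ∈ Finset.univ.erase k, exch η (sgn ε * l k) (points l t j)) = P2 at *
  generalize (∏ j ∈ Finset.univ.erase k, pairWt η (l k) (l j) none (t j)) = P3 at *
  generalize (∏ j ∈ Finset.univ.erase k,
    if t j = none then pairF η (l j) (sgn ε * l k) else 1) = P4 at *
  linear_combination P1 * P2 * R * hsite
    + siteWt d g a (l k) none * bdyWeight g a (sgn ε * l k) * R * hpair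

/-- Summation over the states and one present index, rewritten as a summation over the states with
that index removed. -/
lemma sum_present_eq_sum_absent {n : ℕ} {V : Type*} [AddCommMonoid V]
    (φ : (Fin n → Option ℤˣ) → Fin n → ℤˣ → V) :
    ∑ t : Fin n → Option ℤˣ, ∑ k, (t k).elim 0 (fun ε => φ (Function.update t k none) k ε)
      = ∑ t, ∑ k ∈ absent t, ∑ ε, φ t k ε := by
  have h1 : ∀ t : Fin n → Option ℤˣ, ∀ k,
      (t k).elim 0 (fun ε => φ (Function.update t k none) k ε)
      = ∑ ε, if t k = some ε then φ (Function.update t k none) k ε else 0 := by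
    intro t k
    cases t k with
    | none => simp
    | some δ =>
      simp only [Option.elim_some, Option.some.injEq, Finset.sum_ite_eq, Finset.mem_univ, if_true]
  have h2 : ∀ t : Fin n → Option ℤˣ, ∑ k ∈ absent t, ∑ ε, φ t k ε
      = ∑ k, ∑ ε, if t k = none then φ t k ε else 0 := by
    intro t
    rw [absent, Finset.sum_filter]
    refine Finset.sum_congr rfl fun k _ => ?_
    split_ifs <;> simp
  simp only [h1, h2]
  rw [Finset.sum_comm, Finset.sum_comm (s := (Finset.univ : Finset (Fin n → Option ℤˣ)))]
  refine Finset.sum_congr rfl fun k _ => ?_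
  rw [Finset.sum_comm, Finset.sum_comm (s := (Finset.univ : Finset (Fin n → Option ℤˣ)))]
  refine Finset.sum_congr rfl fun ε _ => ?_
  rw [← Finset.sum_filter, ← Finset.sum_filter]
  refine Finset.sum_nbij' (fun t => Function.update t k none)
    (fun t => Function.update t k (some ε)) ?_ ?_ ?_ ?_ ?_
  · intro t ht; simp
  · intro t ht; simp
  · intro t ht
    simp only [Finset.mem_filter, Finset.mem_univ, true_and] at ht
    simp [← ht]
  · intro t ht
    simp only [Finset.mem_filter, Finset.mem_univ, true_and] at ht
    simp [← ht]
  · intro t ht; rfl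

section
variable {V : Type*} [AddCommGroup V] [Module ℂ V] {η : ℂ} {B D : ℂ → V →ₗ[ℂ] V} {d : ℂ → ℂ}
  {v₀ : V}

/-- The action of `D u` on a linear combination of bulk states, with the coefficients compared to
`stateCoef`. Removing a bulk parameter turns the weights into the terms of `poleSum`. -/
lemma IsExchange.D_sum_bulkState (h : IsExchange η B D d v₀) (g a : ℂ) {n : ℕ} (l : Fin n → ℂ)
    (hll : ∀ i j, i ≠ j → l i ^ 2 ≠ l j ^ 2) (u : ℂ) (hu : ∀ j, u ^ 2 ≠ l j ^ 2)
    (α : (Fin n → Option ℤˣ) → ℂ) :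
    D u (∑ t, (stateCoef η d g a l t * α t) • bulkState B v₀ (points l t))
      = ∑ t, (stateCoef η d g a l t * (α t * (d u * ∏ j, exch η u (points l t j))))
          • bulkState B v₀ (points l t)
        + ∑ t, (stateCoef η d g a l t * ∑ k ∈ absent t, ∑ ε,
            α (Function.update t k (some ε)) * (η / (sgn ε * l k - u) * bdyWeight g a (sgn ε * l k)
              * ∏ i ∈ (absent t).erase k, pairF η (l i) (sgn ε * l k)))
          • B u (bulkState B v₀ (points l t)) := by
  have hD : ∀ t : Fin n → Option ℤˣ, D u (bulkState B v₀ (points l t)) =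
      (d u * ∏ j, exch η u (points l t j)) • bulkState B v₀ (points l t)
      + ∑ k, (points l t k).elim 0 fun y =>
        (η / (y - u) * d y * ∏ j, exch η y (Function.update (points l t) k none j))
          • B u (bulkState B v₀ (Function.update (points l t) k none)) := by
    intro t
    refine h.D_bulkState _ ?_ _ ?_
    · intro i j x hij hi hj
      simp only [points, Option.map_eq_some_iff] at hi hj
      obtain ⟨ε, -, hε⟩ := hi
      obtain ⟨δ, -, hδ⟩ := hj
      exact hll i j hij (by rw [← sgn_mul_sq ε, hε, ← sgn_mul_sq δ (l j), hδ])
    · intro j hj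
      simp only [points, Option.map_eq_some_iff] at hj
      obtain ⟨ε, -, hε⟩ := hj
      exact hu j (by rw [← hε, sgn_mul_sq])
  simp only [map_sum, map_smul, hD, smul_add, smul_smul, Finset.sum_add_distrib]
  congr 1
  · exact Finset.sum_congr rfl fun t _ => by rw [mul_assoc]
  have hterm : ∀ t : Fin n → Option ℤˣ, (stateCoef η d g a l t * α t) •
        (∑ k, (points l t k).elim 0 fun y =>
        (η / (y - u) * d y * ∏ j, exch η y (Function.update (points l t) k none j))
          • B u (bulkState B v₀ (Function.update (points l t) k none)))
      = ∑ k, (t k).elim 0 fun ε => (fun (s : Fin n → Option ℤˣ) (k : Fin n) (ε : ℤˣ) =>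
          (stateCoef η d g a l (Function.update s k (some ε)) * α (Function.update s k (some ε))
            * (η / (sgn ε * l k - u) * d (sgn ε * l k) * ∏ j, exch η (sgn ε * l k) (points l s j)))
            • B u (bulkState B v₀ (points l s))) (Function.update t k none) k ε := by
    intro t
    rw [Finset.smul_sum]
    refine Finset.sum_congr rfl fun k _ => ?_
    rw [points_update]
    cases hk : t k with
    | none => simp [points, hk]
    | some ε =>
      have : Function.update (Function.update t k none) k (some ε) = t := by simp [← hk]
      simp only [points, hk, Option.map_some, Option.elim_some, this, smul_smul]
  rw [Finset.sum_congr rfl fun t _ => hterm t]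
  refine (sum_present_eq_sum_absent fun (s : Fin n → Option ℤˣ) (k : Fin n) (ε : ℤˣ) =>
    (stateCoef η d g a l (Function.update s k (some ε)) * α (Function.update s k (some ε))
      * (η / (sgn ε * l k - u) * d (sgn ε * l k) * ∏ j, exch η (sgn ε * l k) (points l s j)))
      • B u (bulkState B v₀ (points l s))).trans ?_
  refine Finset.sum_congr rfl fun t _ => ?_
  rw [Finset.mul_sum, Finset.sum_smul]
  refine Finset.sum_congr rfl fun k hk => ?_
  rw [Finset.mul_sum, Finset.sum_smul]
  refine Finset.sum_congr rfl fun ε _ => ?_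
  congr 1
  have hk' : t k = none := by simpa [absent] using hk
  linear_combination (α (Function.update t k (some ε)) * (η / (sgn ε * l k - u)))
    * stateCoef_update_some η d g a l hll t k hk' ε

end

/-! ### The boundary operator on combinations of bulk states -/

section
variable {V : Type*} [AddCommGroup V] [Module ℂ V] {η : ℂ} {B D : ℂ → V →ₗ[ℂ] V} {d : ℂ → ℂ}
  {v₀ : V}

/-- The boundary creation operator `∑ h(x) B(x) D(-x) + c D(-v) D(v)`, with the sum over `x = ± v`
and the weight `h = bdyWeight g a`. -/
def bdyOp (B D : ℂ → V →ₗ[ℂ] V) (g a c v : ℂ) (w : V) : V :=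
  bdyWeight g a v • B v (D (-v) w) + bdyWeight g a (-v) • B (-v) (D v w) + c • D (-v) (D v w)

lemma poleSum_empty {ι : Type*} [DecidableEq ι] (g a : ℂ) (l : ι → ℂ) (w : ℂ) :
    poleSum η g a l ∅ w = 0 := by simp [poleSum]

/-- The truncated subtraction is harmless: for empty `T` the sum vanishes. This form of the
coefficients avoids a division by `c`, which may be zero. -/
lemma mul_pow_pred_mul_poleSum {ι : Type*} [DecidableEq ι] (g a c : ℂ) (l : ι → ℂ) (T : Finset ι)
    (w : ℂ) : c * (c ^ (T.card - 1) * poleSum η g a l T w) = c ^ T.card * poleSum η g a l T w := by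
  rcases T.eq_empty_or_nonempty with rfl | hT
  · simp [poleSum_empty]
  · rw [← mul_assoc, ← pow_succ', Nat.sub_add_cancel hT.card_pos]

lemma prod_exch_update {n : ℕ} (l : Fin n → ℂ) (t : Fin n → Option ℤˣ) (k : Fin n)
    (hk : k ∈ absent t) (ε : ℤˣ) (u : ℂ) :
    ∏ j, exch η u (points l (Function.update t k (some ε)) j)
      = (u - sgn ε * l k + η) / (u - sgn ε * l k) * ∏ j, exch η u (points l t j) := by
  have hk' : t k = none := by simpa [absent] using hk
  rw [← Finset.mul_prod_erase _ _ (Finset.mem_univ k),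
    ← Finset.mul_prod_erase _ (fun j => exch η u (points l t j)) (Finset.mem_univ k)]
  simp only [points, hk', Function.update_self, exch, Option.map_some, Option.map_none,
    Option.elim_some, Option.elim_none, one_mul]
  congr 1
  exact Finset.prod_congr rfl fun j hj => by
    rw [Function.update_of_ne (Finset.ne_of_mem_erase hj)]

lemma prod_pairWt_none {n : ℕ} (l : Fin n → ℂ) (t : Fin n → Option ℤˣ) (v : ℂ) :
    ∏ j, pairWt η v (l j) none (t j)
      = (∏ j, exch η v (points l t j)) * ∏ j, exch η (-v) (points l t j) := by
  rw [← Finset.prod_mul_distrib]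
  refine Finset.prod_congr rfl fun j _ => ?_
  cases ht : t j with
  | none => simp [pairWt, points, ht, exch]
  | some ε =>
    simp only [pairWt, points, ht, exch, Option.map_some, Option.elim_some, pairF]
    rw [div_mul_div_comm, ← neg_div_neg_eq]
    congr 1 <;> ring

lemma prod_pairWt_some {n : ℕ} (l : Fin n → ℂ) (t : Fin n → Option ℤˣ) (v : ℂ) (ε : ℤˣ) :
    ∏ j, pairWt η v (l j) (some ε) (t j)
      = (∏ i ∈ absent t, pairF η (l i) (sgn ε * v))
        * ∏ j, exch η (-(sgn ε * v)) (points l t j) := by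
  rw [absent, Finset.prod_filter, ← Finset.prod_mul_distrib]
  refine Finset.prod_congr rfl fun j _ => ?_
  cases ht : t j with
  | none => simp [pairWt, points, ht, exch]
  | some ε =>
    simp only [pairWt, points, ht, exch, Option.map_some, Option.elim_some, reduceCtorEq,
      if_false, one_mul]
    rw [← neg_div_neg_eq]
    congr 1 <;> ring

/-- The partial fraction step that reduces the terms with one exchanged argument to `poleSum`. -/
lemma sum_exch_mul_pole {ι : Type*} [DecidableEq ι] (g a : ℂ) (l : ι → ℂ) (T : Finset ι) (v : ℂ)
    (hv : v ≠ 0) (hvl : ∀ i ∈ T, v ^ 2 ≠ l i ^ 2) :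
    ∑ k ∈ T, ∑ ε : ℤˣ, (v - sgn ε * l k + η) / (v - sgn ε * l k)
        * (η / (sgn ε * l k - -v) * bdyWeight g a (sgn ε * l k)
          * ∏ i ∈ T.erase k, pairF η (l i) (sgn ε * l k))
      = (2 * v + η) / (2 * v) * poleSum η g a l T (-v) - η / (2 * v) * poleSum η g a l T v := by
  simp only [poleSum, Finset.mul_sum, ← Finset.sum_sub_distrib]
  refine Finset.sum_congr rfl fun k hk => Finset.sum_congr rfl fun ε _ => ?_
  have hx2 := sgn_mul_sq ε (l k)
  have h1 : sgn ε * l k - v ≠ 0 := fun h => hvl k hk (by rw [← hx2, sub_eq_zero.1 h])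
  have h2 : sgn ε * l k + v ≠ 0 := fun h => hvl k hk (by
    rw [← hx2, eq_neg_of_add_eq_zero_left h]; ring)
  rw [sub_neg_eq_add, ← neg_sub (sgn ε * l k) v]
  generalize ∏ i ∈ T.erase k, pairF η (l i) (sgn ε * l k) = R at *
  generalize bdyWeight g a (sgn ε * l k) = b at *
  generalize sgn ε * l k = x at *
  field_simp
  ring

/-- The boundary operator maps the expansion over the states of `n` indices to the expansion over
the states of `n + 1` indices, where the new index is absent or carries `v` or `-v`. -/
lemma IsExchange.bdyOp_sum_bulkState (h : IsExchange η B D d v₀) (g a c : ℂ) {n : ℕ}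
    (l : Fin n → ℂ) (hl : ∀ j, l j ≠ 0) (hll : ∀ i j, i ≠ j → l i ^ 2 ≠ l j ^ 2) (v : ℂ)
    (hv : v ≠ 0) (hvl : ∀ j, v ^ 2 ≠ l j ^ 2) :
    bdyOp B D g a c v (∑ t, (stateCoef η d g a l t * c ^ (absent t).card)
        • bulkState B v₀ (points l t))
      = ∑ t, ((siteWt d g a v none * ∏ j, pairWt η v (l j) none (t j)) * stateCoef η d g a l t
            * c ^ ((absent t).card + 1)) • bulkState B v₀ (points l t)
        + ∑ t, ∑ ε, ((siteWt d g a v (some ε) * ∏ j, pairWt η v (l j) (some ε) (t j))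
            * stateCoef η d g a l t * c ^ (absent t).card)
            • B (sgn ε * v) (bulkState B v₀ (points l t)) := by
  have hnv : ∀ j, (-v) ^ 2 ≠ l j ^ 2 := fun j => by rw [neg_sq]; exact hvl j
  have hvv : -v ≠ v := fun e => hv (by linear_combination -e / 2)
  have hcard : ∀ (t : Fin n → Option ℤˣ) (k) (_ : k ∈ absent t) (ε : ℤˣ),
      (absent (Function.update t k (some ε))).card = (absent t).card - 1 := fun t k hk ε => by
    rw [absent_update_some, Finset.card_erase_of_mem hk]
  -- the action of one `D` on the expansion
  have hD1 : ∀ u, (∀ j, u ^ 2 ≠ l j ^ 2) →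
      D u (∑ t, (stateCoef η d g a l t * c ^ (absent t).card) • bulkState B v₀ (points l t))
      = ∑ t, (stateCoef η d g a l t * (c ^ (absent t).card
            * (d u * ∏ j, exch η u (points l t j)))) • bulkState B v₀ (points l t)
        + B u (∑ t, (stateCoef η d g a l t * (c ^ ((absent t).card - 1)
            * poleSum η g a l (absent t) u)) • bulkState B v₀ (points l t)) := by
    intro u hu
    rw [h.D_sum_bulkState g a l hll u hu, map_sum]
    simp only [map_smul]
    congr 1
    refine Finset.sum_congr rfl fun t _ => ?_
    congr 2
    rw [poleSum, Finset.mul_sum]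
    refine Finset.sum_congr rfl fun k hk => ?_
    rw [Finset.mul_sum]
    exact Finset.sum_congr rfl fun ε _ => by rw [hcard t k hk]
  -- the action of the second `D` on the part where the first one has passed
  have hD2 : D (-v) (∑ t, (stateCoef η d g a l t * (c ^ (absent t).card
            * (d v * ∏ j, exch η v (points l t j)))) • bulkState B v₀ (points l t))
      = ∑ t, (stateCoef η d g a l t * (c ^ (absent t).card
            * (d v * ∏ j, exch η v (points l t j)) * (d (-v) * ∏ j, exch η (-v) (points l t j))))
              • bulkState B v₀ (points l t)
        + ∑ t, (stateCoef η d g a l t * (c ^ ((absent t).card - 1)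
            * (d v * ∏ j, exch η v (points l t j))
            * ((2 * v + η) / (2 * v) * poleSum η g a l (absent t) (-v)
              - η / (2 * v) * poleSum η g a l (absent t) v)))
              • B (-v) (bulkState B v₀ (points l t)) := by
    rw [h.D_sum_bulkState g a l hll (-v) hnv]
    congr 1
    refine Finset.sum_congr rfl fun t _ => ?_
    congr 2
    rw [← sum_exch_mul_pole g a l (absent t) v hv fun i _ => hvl i, Finset.mul_sum]
    refine Finset.sum_congr rfl fun k hk => ?_
    rw [Finset.mul_sum]
    refine Finset.sum_congr rfl fun ε _ => ?_
    rw [hcard t k hk, prod_exch_update l t k hk]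
    ring
  -- the action of the second `D` on the part where the first one has been exchanged
  have hD3 : ∀ u, (∀ j, u ^ 2 ≠ l j ^ 2) →
      D u (∑ t, (stateCoef η d g a l t * (c ^ ((absent t).card - 1)
            * poleSum η g a l (absent t) v)) • bulkState B v₀ (points l t))
      = ∑ t, (stateCoef η d g a l t * (c ^ ((absent t).card - 1)
            * poleSum η g a l (absent t) v * (d u * ∏ j, exch η u (points l t j))))
              • bulkState B v₀ (points l t)
        + ∑ t, (stateCoef η d g a l t * ∑ k ∈ absent t, ∑ ε : ℤˣ,
            c ^ (((absent t).erase k).card - 1) * poleSum η g a l ((absent t).erase k) v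
              * (η / (sgn ε * l k - u) * bdyWeight g a (sgn ε * l k)
                * ∏ i ∈ (absent t).erase k, pairF η (l i) (sgn ε * l k)))
              • B u (bulkState B v₀ (points l t)) := by
    intro u hu
    rw [h.D_sum_bulkState g a l hll u hu]
    simp only [absent_update_some]
  -- the states that contain both `B v` and `B (-v)` cancel
  have hBB : ∀ t : Fin n → Option ℤˣ,
      bdyWeight g a v * (c ^ ((absent t).card - 1) * poleSum η g a l (absent t) (-v))
        + bdyWeight g a (-v) * (c ^ ((absent t).card - 1) * poleSum η g a l (absent t) v)
        + c * ((2 * v - η) / (2 * v) * ∑ k ∈ absent t, ∑ ε : ℤˣ,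
            c ^ (((absent t).erase k).card - 1) * poleSum η g a l ((absent t).erase k) v
              * (η / (sgn ε * l k - -v) * bdyWeight g a (sgn ε * l k)
                * ∏ i ∈ (absent t).erase k, pairF η (l i) (sgn ε * l k))
          + η / (2 * v) * ∑ k ∈ absent t, ∑ ε : ℤˣ,
            c ^ (((absent t).erase k).card - 1) * poleSum η g a l ((absent t).erase k) v
              * (η / (sgn ε * l k - v) * bdyWeight g a (sgn ε * l k)
                * ∏ i ∈ (absent t).erase k, pairF η (l i) (sgn ε * l k))) = 0 := by
    intro t
    have key := poleSum_erase_add η g a l (absent t) (fun i _ => hl i) (fun i _ j _ => hll i j) v hv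
      fun i _ => hvl i
    have : c * ((2 * v - η) / (2 * v) * ∑ k ∈ absent t, ∑ ε : ℤˣ,
            c ^ (((absent t).erase k).card - 1) * poleSum η g a l ((absent t).erase k) v
              * (η / (sgn ε * l k - -v) * bdyWeight g a (sgn ε * l k)
                * ∏ i ∈ (absent t).erase k, pairF η (l i) (sgn ε * l k))
          + η / (2 * v) * ∑ k ∈ absent t, ∑ ε : ℤˣ,
            c ^ (((absent t).erase k).card - 1) * poleSum η g a l ((absent t).erase k) v
              * (η / (sgn ε * l k - v) * bdyWeight g a (sgn ε * l k)
                * ∏ i ∈ (absent t).erase k, pairF η (l i) (sgn ε * l k)))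
        = c ^ ((absent t).card - 1) * ∑ k ∈ absent t, ∑ ε : ℤˣ,
          poleSum η g a l ((absent t).erase k) v *
          (η * ((sgn ε * l k - v + η) / ((sgn ε * l k - v) * (sgn ε * l k + v)))
          * bdyWeight g a (sgn ε * l k)
          * ∏ i ∈ (absent t).erase k, pairF η (l i) (sgn ε * l k)) := by
      simp only [Finset.mul_sum, ← Finset.sum_add_distrib]
      refine Finset.sum_congr rfl fun k hk => Finset.sum_congr rfl fun ε _ => ?_
      have hc := mul_pow_pred_mul_poleSum (η := η) g a c l ((absent t).erase k) v
      rw [Finset.card_erase_of_mem hk] at hc ⊢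
      have hx2 := sgn_mul_sq ε (l k)
      have h1 : sgn ε * l k - v ≠ 0 := fun h => hvl k (by rw [← hx2, sub_eq_zero.1 h])
      have h2 : sgn ε * l k + v ≠ 0 := fun h => hvl k (by
        rw [← hx2, eq_neg_of_add_eq_zero_left h]; ring)
      rw [sub_neg_eq_add]
      generalize ∏ i ∈ (absent t).erase k, pairF η (l i) (sgn ε * l k) = R at *
      generalize bdyWeight g a (sgn ε * l k) = b at *
      generalize sgn ε * l k = x at *
      have hx : (2 * v - η) / (2 * v) * (η / (x + v)) + η / (2 * v) * (η / (x - v))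
          = η * ((x - v + η) / ((x - v) * (x + v))) := by
        field_simp
        ring
      linear_combination
        (((2 * v - η) / (2 * v) * (η / (x + v)) + η / (2 * v) * (η / (x - v))) * b * R) * hc
        + (c ^ ((absent t).card - 1) * poleSum η g a l ((absent t).erase k) v * b * R) * hx
    rw [this]
    linear_combination c ^ ((absent t).card - 1) * key
  -- for the other states, the exchanged terms supply the factors `pairF` of the absent indices
  have hB : ∀ t : Fin n → Option ℤˣ, bdyWeight g a v * c ^ (absent t).card
      + (2 * v - η) / (2 * v) * (c * (c ^ ((absent t).card - 1) * poleSum η g a l (absent t) v))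
      = c ^ (absent t).card * bdyWeight g a v * ∏ i ∈ absent t, pairF η (l i) v := by
    intro t
    have key := two_mul_sub_mul_poleSum η g a l (absent t) (fun i _ => hl i)
      (fun i _ j _ => hll i j) v fun i _ => hvl i
    rw [mul_pow_pred_mul_poleSum, bdyWeight]
    field_simp
    linear_combination c ^ (absent t).card * key
  have hB' : ∀ t : Fin n → Option ℤˣ, bdyWeight g a (-v) * c ^ (absent t).card
      + (2 * v + η) / (2 * v) * (c * (c ^ ((absent t).card - 1) * poleSum η g a l (absent t) (-v)))
      = c ^ (absent t).card * bdyWeight g a (-v) * ∏ i ∈ absent t, pairF η (l i) (-v) := by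
    intro t
    have key := two_mul_sub_mul_poleSum η g a l (absent t) (fun i _ => hl i)
      (fun i _ j _ => hll i j) (-v) fun i _ => hnv i
    rw [mul_pow_pred_mul_poleSum, bdyWeight]
    field_simp
    linear_combination -c ^ (absent t).card * key
  rw [bdyOp, hD1 v hvl, hD1 (-v) hnv, map_add (D (-v)), hD2]
  have hswap : ∀ w, D (-v) (B v w) = ((2 * v - η) / (2 * v)) • B v (D (-v) w)
      + (η / (2 * v)) • B (-v) (D v w) := by
    intro w
    rw [h.exchange _ _ _ hvv, sub_eq_add_neg, ← neg_smul]
    congr 2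
    · rw [← neg_div_neg_eq]; congr 1 <;> ring
    · rw [← div_neg]; congr 1; ring
  rw [hswap, hD3 v hvl, hD3 (-v) hnv]
  simp only [map_add, map_sum, map_smul, smul_add, Finset.smul_sum, smul_smul,
    ← Finset.sum_add_distrib]
  refine Finset.sum_congr rfl fun t _ => ?_
  rw [sum_sgn, prod_pairWt_none, prod_pairWt_some, prod_pairWt_some, h.comm (-v) v]
  simp only [siteWt, Option.elim_some, Option.elim_none, sgn_one, sgn_neg_one, one_mul,
    neg_one_mul, neg_neg, pow_succ]
  linear_combination (norm := module)
    (stateCoef η d g a l t * hBB t) • B v (B (-v) (bulkState B v₀ (points l t)))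
    + ((stateCoef η d g a l t * d (-v) * ∏ j, exch η (-v) (points l t j)) * hB t)
      • B v (bulkState B v₀ (points l t))
    + ((stateCoef η d g a l t * d v * ∏ j, exch η v (points l t j)) * hB' t)
      • B (-v) (bulkState B v₀ (points l t))

lemma stateCoef_cons {d : ℂ → ℂ} (g a : ℂ) {n : ℕ} (l : Fin (n + 1) → ℂ) (o : Option ℤˣ)
    (t : Fin n → Option ℤˣ) :
    stateCoef η d g a l (Fin.cons o t : Fin (n + 1) → Option ℤˣ)
      = (siteWt d g a (l 0) o * ∏ j : Fin n, pairWt η (l 0) (l j.succ) o (t j))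
        * stateCoef η d g a (fun j => l j.succ) t := by
  simp only [stateCoef, Fin.prod_univ_succ, Fin.cons_zero, Fin.cons_succ, if_false,
    Fin.succ_pos, if_true, Fin.not_lt_zero, Fin.succ_lt_succ_iff, one_mul]
  ring

lemma card_absent_cons {n : ℕ} (o : Option ℤˣ) (t : Fin n → Option ℤˣ) :
    (absent (Fin.cons o t : Fin (n + 1) → Option ℤˣ)).card
      = (absent t).card + o.elim 1 fun _ => 0 := by
  simp only [absent, Finset.card_filter, Fin.sum_univ_succ, Fin.cons_zero, Fin.cons_succ]
  cases o <;> simp [add_comm]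

lemma points_cons {n : ℕ} (l : Fin (n + 1) → ℂ) (o : Option ℤˣ) (t : Fin n → Option ℤˣ) :
    points l (Fin.cons o t : Fin (n + 1) → Option ℤˣ)
      = Fin.cons (o.map fun ε => sgn ε * l 0) (points (fun j => l j.succ) t) := by
  ext1 i
  refine Fin.cases ?_ (fun j => ?_) i <;> simp [points]

/-- The expansion of a product of boundary operators over the bulk states. -/
theorem IsExchange.foldr_bdyOp (h : IsExchange η B D d v₀) (g a c : ℂ) {n : ℕ}
    (l : Fin n → ℂ) (hl : ∀ j, l j ≠ 0) (hll : ∀ i j, i ≠ j → l i ^ 2 ≠ l j ^ 2) :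
    (List.ofFn l).foldr (bdyOp B D g a c) v₀
      = ∑ t, (stateCoef η d g a l t * c ^ (absent t).card) • bulkState B v₀ (points l t) := by
  induction n with
  | zero => simp [stateCoef, absent, bulkState]
  | succ n ih =>
    have hll' : ∀ i j : Fin n, i ≠ j → l i.succ ^ 2 ≠ l j.succ ^ 2 := fun i j hij =>
      hll _ _ (by simpa using hij)
    rw [List.ofFn_succ, List.foldr_cons, ih (fun j => l j.succ) (fun j => hl _) hll',
      h.bdyOp_sum_bulkState g a c _ (fun j => hl _) hll' (l 0) (hl 0)
        (fun j => hll _ _ (Fin.succ_ne_zero j).symm)]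
    rw [← (Fin.consEquiv fun _ : Fin (n + 1) => Option ℤˣ).sum_comp, Fintype.sum_prod_type,
      Fintype.sum_option]
    congr 1
    · refine Finset.sum_congr rfl fun t _ => ?_
      change _ = (stateCoef η d g a l (Fin.cons none t : Fin (n + 1) → Option ℤˣ)
        * _ ^ (absent (Fin.cons none t : Fin (n + 1) → Option ℤˣ)).card)
        • bulkState B v₀ (points l (Fin.cons none t : Fin (n + 1) → Option ℤˣ))
      rw [stateCoef_cons, card_absent_cons, points_cons, Option.map_none, bulkState_cons]
      rfl
    · rw [Finset.sum_comm]
      refine Finset.sum_congr rfl fun ε _ => Finset.sum_congr rfl fun t _ => ?_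
      change _ = (stateCoef η d g a l (Fin.cons (some ε) t : Fin (n + 1) → Option ℤˣ)
        * _ ^ (absent (Fin.cons (some ε) t : Fin (n + 1) → Option ℤˣ)).card)
        • bulkState B v₀ (points l (Fin.cons (some ε) t : Fin (n + 1) → Option ℤˣ))
      rw [stateCoef_cons, card_absent_cons, points_cons, Option.map_some, bulkState_cons]
      rfl

end

/-! ### Product operators on the quantum space -/

/-- The tensor product `⊗ₙ aₙ` of 2×2 matrices, acting on `ℋ`. -/
def tens {N : ℕ} (a : Fin N → Matrix (Fin 2) (Fin 2) ℂ) : Op N := fun s t => ∏ n, a n (s n) (t n)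

lemma tens_mul {N : ℕ} (a b : Fin N → Matrix (Fin 2) (Fin 2) ℂ) :
    tens a * tens b = tens fun n => a n * b n := by
  ext s t
  simp only [tens, Matrix.mul_apply, Finset.prod_univ_sum, Fintype.piFinset_univ,
    Finset.prod_mul_distrib]

lemma tens_one {N : ℕ} : tens (fun _ : Fin N => 1) = 1 := by
  ext s t
  simp only [tens, Matrix.one_apply, Finset.prod_ite_zero, Finset.prod_const_one, funext_iff,
    Finset.mem_univ, true_imp_iff]

lemma siteOp_eq_tens {N : ℕ} (n : Fin N) (m : Matrix (Fin 2) (Fin 2) ℂ) :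
    siteOp n m = tens (Function.update (fun _ => 1) n m) := by
  ext s t
  rw [tens, ← Finset.mul_prod_erase _ _ (Finset.mem_univ n), Function.update_self]
  have : ∏ k ∈ Finset.univ.erase n,
        Function.update (fun _ : Fin N => (1 : Matrix (Fin 2) (Fin 2) ℂ)) n m k (s k) (t k)
      = ∏ k ∈ Finset.univ.erase n, if s k = t k then (1 : ℂ) else 0 :=
    Finset.prod_congr rfl fun k hk => by
      rw [Function.update_of_ne (Finset.ne_of_mem_erase hk), Matrix.one_apply]
  rw [this, Finset.prod_ite_zero]
  simp only [siteOp, Finset.mem_erase, Finset.mem_univ, and_true, Finset.prod_const_one, mul_ite,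
    mul_one, mul_zero]

lemma siteOp_mul {N : ℕ} (n : Fin N) (m m' : Matrix (Fin 2) (Fin 2) ℂ) :
    siteOp n m * siteOp n m' = siteOp n (m * m') := by
  rw [siteOp_eq_tens, siteOp_eq_tens, siteOp_eq_tens, tens_mul]
  congr 1
  ext1 k
  by_cases h : k = n
  · subst h; simp
  · simp [h]

lemma siteOp_commute {N : ℕ} {n k : Fin N} (h : n ≠ k) (m m' : Matrix (Fin 2) (Fin 2) ℂ) :
    Commute (siteOp n m) (siteOp k m') := by
  rw [Commute, SemiconjBy, siteOp_eq_tens, siteOp_eq_tens, tens_mul, tens_mul]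
  congr 1
  ext1 i
  by_cases h1 : i = n
  · subst h1; simp [h]
  · by_cases h2 : i = k
    · subst h2; simp [h1]
    · simp [h1, h2]

lemma siteOp_add {N : ℕ} (n : Fin N) (m m' : Matrix (Fin 2) (Fin 2) ℂ) :
    siteOp n (m + m') = siteOp n m + siteOp n m' := by
  ext s t
  simp only [siteOp, Matrix.add_apply]
  split_ifs <;> simp

lemma siteOp_smul {N : ℕ} (n : Fin N) (c : ℂ) (m : Matrix (Fin 2) (Fin 2) ℂ) :
    siteOp n (c • m) = c • siteOp n m := by
  ext s t
  simp only [siteOp, Matrix.smul_apply, smul_eq_mul]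
  split_ifs <;> simp

/-! ### The Yang–Baxter algebra -/

/-- The `RTT` relation `R(u - v) T₁(u) S₂(v) = S₂(v) T₁(u) R(u - v)`, in components. -/
def RTT {N : ℕ} (η u v : ℂ) (T S : AuxOp N) : Prop :=
  ∀ i j k l, (u - v) • (T i j * S k l) + η • (T k j * S i l)
    = (u - v) • (S k l * T i j) + η • (S k j * T i l)

lemma mul_apply_mul_mul_apply {N : ℕ} (A A' Q Q' : AuxOp N)
    (h : ∀ i j k l, Commute (Q i j) (A' k l)) (i j k l : Fin 2) :
    (A * Q) i j * (A' * Q') k l = ∑ a, ∑ b, A i a * A' k b * (Q a j * Q' b l) := by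
  simp only [Matrix.mul_apply, Finset.sum_mul_sum]
  refine Finset.sum_congr rfl fun a _ => Finset.sum_congr rfl fun b _ => ?_
  rw [mul_assoc, ← mul_assoc (Q a j), (h a j k b).eq, mul_assoc, mul_assoc]

/-- The comultiplication property: the `RTT` relation passes to products of monodromy matrices that
act on different parts of the quantum space. -/
lemma RTT.mul {N : ℕ} {η u v : ℂ} {S S' Q Q' : AuxOp N} (hS : RTT η u v S S')
    (hQ : RTT η u v Q Q') (h : ∀ i j k l, Commute (Q i j) (S' k l))
    (h' : ∀ i j k l, Commute (Q' i j) (S k l)) : RTT η u v (S * Q) (S' * Q') := by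
  intro i j k l
  rw [mul_apply_mul_mul_apply _ _ _ _ h, mul_apply_mul_mul_apply _ _ _ _ h,
    mul_apply_mul_mul_apply _ _ _ _ h', mul_apply_mul_mul_apply _ _ _ _ h']
  have e1 : (u - v) • ∑ a, ∑ b, S i a * S' k b * (Q a j * Q' b l)
        + η • ∑ a, ∑ b, S k a * S' i b * (Q a j * Q' b l)
      = ∑ a, ∑ b, ((u - v) • (S' k b * S i a) + η • (S' k a * S i b)) * (Q a j * Q' b l) := by
    simp only [Finset.smul_sum, ← Finset.sum_add_distrib]
    refine Finset.sum_congr rfl fun a _ => Finset.sum_congr rfl fun b _ => ?_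
    rw [← hS i a k b, add_mul, smul_mul_assoc, smul_mul_assoc]
  have e2 : (u - v) • ∑ a, ∑ b, S' k a * S i b * (Q' a l * Q b j)
        + η • ∑ a, ∑ b, S' k a * S i b * (Q' a j * Q b l)
      = ∑ b, ∑ a, (S' k b * S i a) * ((u - v) • (Q a j * Q' b l) + η • (Q b j * Q' a l)) := by
    simp only [Finset.smul_sum, ← Finset.sum_add_distrib]
    refine Finset.sum_congr rfl fun b _ => Finset.sum_congr rfl fun a _ => ?_
    rw [hQ a j b l, mul_add, mul_smul_comm, mul_smul_comm]
  rw [e1, e2]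
  simp only [add_mul, mul_add, Finset.sum_add_distrib, smul_mul_assoc, mul_smul_comm]
  rw [Finset.sum_comm]

lemma RTT.one {N : ℕ} (η u v : ℂ) : RTT η u v (1 : AuxOp N) 1 := by
  intro i j k l
  have h : ∀ i j k l : Fin 2, (1 : AuxOp N) i j * (1 : AuxOp N) k l
      = (1 : AuxOp N) k l * (1 : AuxOp N) i j := by
    intro i j k l
    simp only [Matrix.one_apply]
    split_ifs <;> simp
  rw [h i j k l, h k j i l]

/-- The 2×2 blocks of the `R`-matrix with respect to its first tensor factor. -/
def blockR (η l : ℂ) (i j : Fin 2) : Matrix (Fin 2) (Fin 2) ℂ :=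
  Matrix.of fun s t => Rmat η l (i, s) (j, t)

lemma Rsite_apply {N : ℕ} (η l : ℂ) (n : Fin N) (i j : Fin 2) :
    Rsite η l n i j = siteOp n (blockR η l i j) := rfl

lemma blockR_apply (η l : ℂ) (i j s t : Fin 2) :
    blockR η l i j s t = (if i = j ∧ s = t then l else 0) + if i = t ∧ s = j then η else 0 := by
  simp [blockR, Rmat]

lemma RTT.site {N : ℕ} (η u v x : ℂ) (n : Fin N) :
    RTT η u v (Rsite η (u - x) n) (Rsite η (v - x) n) := by
  intro i j k l
  simp only [Rsite_apply, siteOp_mul, ← siteOp_smul, ← siteOp_add]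
  congr 1
  ext s t
  simp only [Matrix.add_apply, Matrix.smul_apply, Matrix.mul_apply, Fin.sum_univ_two, smul_eq_mul,
    blockR_apply]
  fin_cases i <;> fin_cases j <;> fin_cases k <;> fin_cases l <;> fin_cases s <;> fin_cases t <;>
    simp [-mul_eq_mul_left_iff] <;> ring

/-- The monodromy matrix of a list of sites. -/
def listMonodromy {N : ℕ} (η : ℂ) (ξ : Fin N → ℂ) (u : ℂ) (L : List (Fin N)) : AuxOp N :=
  (L.map fun n => Rsite η (u - ξ n - η / 2) n).prod

lemma bulkMonodromy_eq {N : ℕ} (η : ℂ) (ξ : Fin N → ℂ) (u : ℂ) :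
    bulkMonodromy η ξ u = listMonodromy η ξ u (List.finRange N).reverse := by
  rw [bulkMonodromy, listMonodromy, List.ofFn_eq_map, List.map_reverse]

lemma listMonodromy_cons {N : ℕ} (η : ℂ) (ξ : Fin N → ℂ) (u : ℂ) (n : Fin N) (L : List (Fin N)) :
    listMonodromy η ξ u (n :: L) = Rsite η (u - ξ n - η / 2) n * listMonodromy η ξ u L := by
  simp [listMonodromy]

lemma listMonodromy_commute {N : ℕ} (η : ℂ) (ξ : Fin N → ℂ) (u : ℂ) (L : List (Fin N)) (n : Fin N)
    (hn : n ∉ L) (m : Matrix (Fin 2) (Fin 2) ℂ) (i j : Fin 2) :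
    Commute (listMonodromy η ξ u L i j) (siteOp n m) := by
  induction L generalizing i j with
  | nil =>
    simp only [listMonodromy, List.map_nil, List.prod_nil, Matrix.one_apply]
    split_ifs
    exacts [Commute.one_left _, Commute.zero_left _]
  | cons k L ih =>
    rw [List.mem_cons, not_or] at hn
    rw [listMonodromy_cons, Matrix.mul_apply]
    exact Commute.sum_left _ _ _ fun a _ =>
      (siteOp_commute (Ne.symm hn.1) _ _).mul_left (ih hn.2 a j)

lemma RTT.listMonodromy {N : ℕ} (η : ℂ) (ξ : Fin N → ℂ) (u v : ℂ) (L : List (Fin N))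
    (hL : L.Nodup) : RTT η u v (listMonodromy η ξ u L) (listMonodromy η ξ v L) := by
  induction L with
  | nil => simpa [OpenXXX.listMonodromy] using RTT.one η u v
  | cons n L ih =>
    rw [List.nodup_cons] at hL
    rw [listMonodromy_cons, listMonodromy_cons, sub_sub, sub_sub]
    exact (RTT.site η u v _ n).mul (ih hL.2)
      (fun i j k l => listMonodromy_commute η ξ u L n hL.1 _ i j)
      (fun i j k l => listMonodromy_commute η ξ v L n hL.1 _ i j)

lemma RTT.bulkMonodromy {N : ℕ} (η : ℂ) (ξ : Fin N → ℂ) (u v : ℂ) :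
    RTT η u v (bulkMonodromy η ξ u) (bulkMonodromy η ξ v) := by
  rw [bulkMonodromy_eq, bulkMonodromy_eq]
  exact RTT.listMonodromy η ξ u v _ (List.nodup_reverse.2 (List.nodup_finRange N))

lemma bulkMonodromy_commute {N : ℕ} (η : ℂ) (ξ : Fin N → ℂ) (u v : ℂ) (i j : Fin 2) :
    Commute (bulkMonodromy η ξ u i j) (bulkMonodromy η ξ v i j) := by
  have h1 := RTT.bulkMonodromy η ξ u v i j i j
  have h2 := RTT.bulkMonodromy η ξ v u i j i j
  rw [← add_smul, ← add_smul] at h1 h2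
  rw [Commute, SemiconjBy]
  -- of the two scalars `u - v + η` and `v - u + η`, one is invertible unless `u = v`
  by_cases h : u - v + η = 0
  · by_cases h' : v - u + η = 0
    · have : u = v := by linear_combination (h - h') / 2
      rw [this]
    · exact (smul_right_injective _ h' h2).symm
  · exact smul_right_injective _ h h1

lemma siteOp_mulVec_vac {N : ℕ} (n : Fin N) (m : Matrix (Fin 2) (Fin 2) ℂ) (c : ℂ)
    (h : ∀ s, m s 0 = if s = 0 then c else 0) : siteOp n m *ᵥ vac N = c • vac N := by
  ext s
  rw [vac, Matrix.mulVec_single_one, Matrix.col_apply, siteOp, Pi.smul_apply, Pi.single_apply, h,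
    smul_eq_mul, mul_ite, mul_one, mul_zero, ← ite_and]
  refine if_congr ⟨fun h => ?_, fun h => by simp [h]⟩ rfl rfl
  ext1 k
  by_cases hk : k = n
  · rw [hk, h.2]
  · exact h.1 k hk

lemma listMonodromy_mulVec_vac {N : ℕ} (η : ℂ) (ξ : Fin N → ℂ) (u : ℂ) (L : List (Fin N))
    (hL : L.Nodup) : listMonodromy η ξ u L 1 0 *ᵥ vac N = 0
      ∧ listMonodromy η ξ u L 1 1 *ᵥ vac N = (L.map fun n => u - ξ n - η / 2).prod • vac N := by
  induction L with
  | nil => simp [listMonodromy]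
  | cons n L ih =>
    rw [List.nodup_cons] at hL
    obtain ⟨ih0, ih1⟩ := ih hL.2
    have hC : Rsite η (u - ξ n - η / 2) n 1 0 *ᵥ vac N = 0 := by
      rw [Rsite_apply, siteOp_mulVec_vac n _ 0, zero_smul]
      simp [blockR_apply]
    have hD : Rsite η (u - ξ n - η / 2) n 1 1 *ᵥ vac N = (u - ξ n - η / 2) • vac N := by
      rw [Rsite_apply, siteOp_mulVec_vac n _ (u - ξ n - η / 2)]
      simp [blockR_apply]
    have hcomm : ∀ j, (Rsite η (u - ξ n - η / 2) n 1 0 * listMonodromy η ξ u L 0 j) *ᵥ vac N = 0 :=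
      fun j => by
        rw [Rsite_apply, ← (listMonodromy_commute η ξ u L n hL.1 _ 0 j).eq, ← Matrix.mulVec_mulVec]
        change _ *ᵥ (Rsite η (u - ξ n - η / 2) n 1 0 *ᵥ vac N) = 0
        rw [hC, Matrix.mulVec_zero]
    rw [listMonodromy_cons, Matrix.mul_apply, Matrix.mul_apply, Fin.sum_univ_two, Fin.sum_univ_two,
      Matrix.add_mulVec, Matrix.add_mulVec, hcomm, hcomm, ← Matrix.mulVec_mulVec,
      ← Matrix.mulVec_mulVec, ih0, ih1, Matrix.mulVec_smul, hD, Matrix.mulVec_zero, smul_smul,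
      List.map_cons, List.prod_cons, mul_comm]
    simp

/-- The bulk operator `D(u)`, the lower right entry of `M(u)`. -/
def bulkD {N : ℕ} (η : ℂ) (ξ : Fin N → ℂ) (u : ℂ) : Op N := bulkMonodromy η ξ u 1 1

lemma isExchange_bulk {N : ℕ} (η : ℂ) (ξ : Fin N → ℂ) :
    IsExchange η (fun u => (bulkB η ξ u).mulVecLin) (fun u => (bulkD η ξ u).mulVecLin)
      (dFun η ξ) (vac N) where
  comm x y v := by
    simp only [Matrix.mulVecLin_apply, Matrix.mulVec_mulVec, bulkB]
    rw [(bulkMonodromy_commute η ξ x y 0 1).eq]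
  exchange x y v hxy := by
    have h0 : x - y ≠ 0 := sub_ne_zero.2 hxy
    have h : (x - y) • (bulkD η ξ x * bulkB η ξ y) + η • (bulkB η ξ x * bulkD η ξ y)
      = (x - y) • (bulkB η ξ y * bulkD η ξ x) + η • (bulkB η ξ y * bulkD η ξ x) :=
      RTT.bulkMonodromy η ξ x y 1 1 0 1
    have h' : bulkD η ξ x * bulkB η ξ y = ((x - y + η) / (x - y)) • (bulkB η ξ y * bulkD η ξ x)
        - (η / (x - y)) • (bulkB η ξ x * bulkD η ξ y) := by
      refine smul_right_injective _ h0 ?_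
      simp only [smul_sub, smul_smul, mul_div_cancel₀ _ h0]
      rw [eq_sub_iff_add_eq, h, ← add_smul]
    simp only [Matrix.mulVecLin_apply, Matrix.mulVec_mulVec, h', Matrix.sub_mulVec,
      Matrix.smul_mulVec]
  vac x := by
    have h := (listMonodromy_mulVec_vac η ξ x (List.finRange N).reverse
      (List.nodup_reverse.2 (List.nodup_finRange N))).2
    rw [Matrix.mulVecLin_apply, bulkD, bulkMonodromy_eq, h, List.map_reverse, List.prod_reverse,
      ← List.ofFn_eq_map, List.prod_ofFn, dFun]

/-! ### The similarity transformation by `W` -/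

lemma auxOp_eq_mapMatrix (N : ℕ) (m : Matrix (Fin 2) (Fin 2) ℂ) :
    auxOp N m = (algebraMap ℂ (Op N)).mapMatrix m := rfl

lemma auxOp_mul {N : ℕ} (m m' : Matrix (Fin 2) (Fin 2) ℂ) :
    auxOp N m * auxOp N m' = auxOp N (m * m') := by
  simp only [auxOp_eq_mapMatrix, map_mul]

lemma auxOp_one {N : ℕ} : auxOp N 1 = 1 := by
  rw [auxOp_eq_mapMatrix, map_one]

lemma transpose_auxOp_mul {N : ℕ} (m : Matrix (Fin 2) (Fin 2) ℂ) (X : AuxOp N) :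
    (auxOp N m * X)ᵀ = Xᵀ * auxOp N mᵀ := by
  ext1 i j
  simp only [Matrix.transpose_apply, Matrix.mul_apply, auxOp, Matrix.map_apply]
  exact Finset.sum_congr rfl fun k _ => Algebra.commutes _ _

lemma transpose_mul_auxOp {N : ℕ} (m : Matrix (Fin 2) (Fin 2) ℂ) (X : AuxOp N) :
    (X * auxOp N m)ᵀ = auxOp N mᵀ * Xᵀ := by
  ext1 i j
  simp only [Matrix.transpose_apply, Matrix.mul_apply, auxOp, Matrix.map_apply]
  exact Finset.sum_congr rfl fun k _ => (Algebra.commutes _ _).symm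

lemma transpose_auxOp {N : ℕ} (m : Matrix (Fin 2) (Fin 2) ℂ) : (auxOp N m)ᵀ = auxOp N mᵀ := rfl

/-- Conjugation by an invertible operator on the quantum space, applied to the entries of a matrix
over the auxiliary space. -/
def conjAux {N : ℕ} (u : (Op N)ˣ) : AuxOp N →+* AuxOp N :=
  (MulSemiringAction.toRingHom (ConjAct (Op N)ˣ) (Op N) (ConjAct.toConjAct u)).mapMatrix

lemma conjAux_apply {N : ℕ} (u : (Op N)ˣ) (X : AuxOp N) :
    conjAux u X = X.map fun x => (u : Op N) * x * ((u⁻¹ : (Op N)ˣ) : Op N) := by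
  ext1 i j
  simp [conjAux, ConjAct.units_smul_def]

lemma conjAux_auxOp {N : ℕ} (u : (Op N)ˣ) (m : Matrix (Fin 2) (Fin 2) ℂ) :
    conjAux u (auxOp N m) = auxOp N m := by
  rw [conjAux_apply]
  ext1 i j
  simp only [Matrix.map_apply, auxOp]
  rw [← Algebra.commutes, mul_assoc, Units.mul_inv, mul_one]

lemma conjAux_transpose {N : ℕ} (u : (Op N)ˣ) (X : AuxOp N) :
    conjAux u Xᵀ = (conjAux u X)ᵀ := rfl

lemma Γ_eq_tens (N : ℕ) (w : Matrix (Fin 2) (Fin 2) ℂ) : Γ N w = tens fun _ => w := rfl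

/-- `Γ_w` as an invertible operator. -/
def ΓUnit (N : ℕ) (w : (Matrix (Fin 2) (Fin 2) ℂ)ˣ) : (Op N)ˣ where
  val := Γ N w
  inv := Γ N ((w⁻¹ : (Matrix (Fin 2) (Fin 2) ℂ)ˣ) : Matrix (Fin 2) (Fin 2) ℂ)
  val_inv := by rw [Γ_eq_tens, Γ_eq_tens, tens_mul, Units.mul_inv, tens_one]
  inv_val := by rw [Γ_eq_tens, Γ_eq_tens, tens_mul, Units.inv_mul, tens_one]

/-- The invariance of the `R`-matrix under the simultaneous action of a matrix on both factors. -/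
lemma mul_blockR_mul (w : (Matrix (Fin 2) (Fin 2) ℂ)ˣ) (η l : ℂ) (i j : Fin 2) :
    (w : Matrix (Fin 2) (Fin 2) ℂ) * blockR η l i j * (w⁻¹ : (Matrix (Fin 2) (Fin 2) ℂ)ˣ)
      = ∑ b, ∑ a, (((w⁻¹ : (Matrix (Fin 2) (Fin 2) ℂ)ˣ) : Matrix (Fin 2) (Fin 2) ℂ) i a
        * (w : Matrix (Fin 2) (Fin 2) ℂ) b j) • blockR η l a b := by
  have h1 : (w : Matrix (Fin 2) (Fin 2) ℂ) * (w⁻¹ : (Matrix (Fin 2) (Fin 2) ℂ)ˣ) = 1 :=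
    Units.mul_inv w
  have h2 : ((w⁻¹ : (Matrix (Fin 2) (Fin 2) ℂ)ˣ) : Matrix (Fin 2) (Fin 2) ℂ) * w = 1 :=
    Units.inv_mul w
  generalize ((w⁻¹ : (Matrix (Fin 2) (Fin 2) ℂ)ˣ) : Matrix (Fin 2) (Fin 2) ℂ) = w' at *
  generalize (w : Matrix (Fin 2) (Fin 2) ℂ) = w at *
  ext s t
  have e1 := congrFun (congrFun h1 s) t
  have e2 := congrFun (congrFun h2 i) j
  simp only [Matrix.mul_apply, Fin.sum_univ_two, Matrix.one_apply] at e1 e2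
  simp only [Matrix.mul_apply, Matrix.add_apply, Matrix.smul_apply, Fin.sum_univ_two, smul_eq_mul,
    blockR_apply]
  fin_cases i <;> fin_cases j <;> fin_cases s <;> fin_cases t <;> simp at e1 e2 ⊢ <;>
    first
    | linear_combination l * e1 - l * e2
    | linear_combination l * e1
    | linear_combination - l * e2
    | ring

lemma conjAux_Rsite {N : ℕ} (w : (Matrix (Fin 2) (Fin 2) ℂ)ˣ) (η l : ℂ) (n : Fin N) :
    conjAux (ΓUnit N w) (Rsite η l n)
      = auxOp N (w⁻¹ : (Matrix (Fin 2) (Fin 2) ℂ)ˣ) * Rsite η l n * auxOp N w := by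
  rw [conjAux_apply]
  ext1 i j
  have h : ∀ m, Γ N w * siteOp n m * Γ N ((w⁻¹ : (Matrix (Fin 2) (Fin 2) ℂ)ˣ) :
      Matrix (Fin 2) (Fin 2) ℂ) = siteOp n (w * m * (w⁻¹ : (Matrix (Fin 2) (Fin 2) ℂ)ˣ)) := by
    intro m
    rw [Γ_eq_tens, Γ_eq_tens, siteOp_eq_tens, siteOp_eq_tens, tens_mul, tens_mul]
    congr 1
    ext1 k
    by_cases hk : k = n
    · subst hk; simp
    · simp [hk]
  have hsum : ∀ (c d e f : ℂ) (x y z t : Matrix (Fin 2) (Fin 2) ℂ),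
      siteOp n (c • x + d • y + (e • z + f • t)) = c • siteOp n x + d • siteOp n y
        + (e • siteOp n z + f • siteOp n t) := by
    intros; simp only [siteOp_add, siteOp_smul]
  refine (h _).trans ?_
  change siteOp n (_ * blockR η l i j * _) = _
  rw [mul_blockR_mul]
  simp only [Fin.sum_univ_two, hsum, Matrix.mul_apply, auxOp, Matrix.map_apply, Rsite_apply,
    Algebra.algebraMap_eq_smul_one, smul_mul_assoc, mul_smul_comm, one_mul, mul_one,
    smul_add, smul_smul]
  simp only [mul_comm]

lemma auxOp_inv_mul {N : ℕ} (w : (Matrix (Fin 2) (Fin 2) ℂ)ˣ) :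
    auxOp N (w⁻¹ : (Matrix (Fin 2) (Fin 2) ℂ)ˣ) * auxOp N w = 1 := by
  rw [auxOp_mul, Units.inv_mul, auxOp_one]

lemma auxOp_mul_inv {N : ℕ} (w : (Matrix (Fin 2) (Fin 2) ℂ)ˣ) :
    auxOp N w * auxOp N (w⁻¹ : (Matrix (Fin 2) (Fin 2) ℂ)ˣ) = 1 := by
  rw [auxOp_mul, Units.mul_inv, auxOp_one]

/-- Conjugation by `Γ_w` on the quantum space undoes conjugation by `w` on the auxiliary space. -/
lemma conjAux_bulkMonodromy {N : ℕ} (w : (Matrix (Fin 2) (Fin 2) ℂ)ˣ) (η : ℂ) (ξ : Fin N → ℂ)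
    (u : ℂ) : conjAux (ΓUnit N w) (bulkMonodromy η ξ u)
      = auxOp N (w⁻¹ : (Matrix (Fin 2) (Fin 2) ℂ)ˣ) * bulkMonodromy η ξ u * auxOp N w := by
  rw [bulkMonodromy_eq]
  generalize (List.finRange N).reverse = L
  induction L with
  | nil => rw [listMonodromy, List.map_nil, List.prod_nil, map_one, mul_one, auxOp_inv_mul]
  | cons n L ih =>
    rw [listMonodromy_cons, map_mul, ih, conjAux_Rsite]
    simp only [mul_assoc]
    rw [← mul_assoc (auxOp N (w : Matrix (Fin 2) (Fin 2) ℂ)), auxOp_mul_inv, one_mul]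

lemma pauliY_mul_transpose_mul (m : Matrix (Fin 2) (Fin 2) ℂ) :
    pauliY * mᵀ * pauliY = m.adjugate := by
  have hI : ∀ x : ℂ, Complex.I * x * Complex.I = -x := fun x => by
    linear_combination x * Complex.I_mul_I
  have hm : mᵀ = !![m 0 0, m 1 0; m 0 1, m 1 1] := by
    ext i j
    fin_cases i <;> fin_cases j <;> rfl
  rw [hm, pauliY, Matrix.mul_fin_two, Matrix.mul_fin_two, Matrix.adjugate_fin_two]
  simp [hI]

lemma pauliY_mul_self : pauliY * pauliY = 1 := by
  ext i j
  fin_cases i <;> fin_cases j <;> simp [pauliY, Matrix.mul_apply, Fin.sum_univ_two]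

lemma auxOp_smul {N : ℕ} (c : ℂ) (m : Matrix (Fin 2) (Fin 2) ℂ) :
    auxOp N (c • m) = c • auxOp N m := by
  ext1 i j
  simp only [auxOp, Matrix.map_apply, Matrix.smul_apply, smul_eq_mul, map_mul]
  rw [Algebra.smul_def]

lemma conjAux_bulkMonodromyHat {N : ℕ} (w : (Matrix (Fin 2) (Fin 2) ℂ)ˣ) (η : ℂ) (ξ : Fin N → ℂ)
    (u : ℂ) : conjAux (ΓUnit N w) (bulkMonodromyHat η ξ u)
      = auxOp N (w⁻¹ : (Matrix (Fin 2) (Fin 2) ℂ)ˣ) * bulkMonodromyHat η ξ u * auxOp N w := by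
  -- `σʸ mᵗ σʸ` is the adjugate of `m`, a multiple of the inverse
  have hadj : ∀ v : (Matrix (Fin 2) (Fin 2) ℂ)ˣ, pauliY * (v : Matrix (Fin 2) (Fin 2) ℂ)ᵀ
      = (v : Matrix (Fin 2) (Fin 2) ℂ).det
        • (((v⁻¹ : (Matrix (Fin 2) (Fin 2) ℂ)ˣ) : Matrix (Fin 2) (Fin 2) ℂ) * pauliY) := by
    intro v
    have : (v : Matrix (Fin 2) (Fin 2) ℂ).adjugate
        = (v : Matrix (Fin 2) (Fin 2) ℂ).det • (v⁻¹ : (Matrix (Fin 2) (Fin 2) ℂ)ˣ) := by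
      rw [← one_mul (Matrix.adjugate _), ← Units.inv_mul v, mul_assoc, Matrix.mul_adjugate,
        Matrix.mul_smul, mul_one]
    rw [← mul_one (pauliY * _), ← pauliY_mul_self, ← mul_assoc, pauliY_mul_transpose_mul, this,
      Matrix.smul_mul]
  have hadj' : ∀ v : (Matrix (Fin 2) (Fin 2) ℂ)ˣ, (v : Matrix (Fin 2) (Fin 2) ℂ)ᵀ * pauliY
      = (v : Matrix (Fin 2) (Fin 2) ℂ).det
        • (pauliY * ((v⁻¹ : (Matrix (Fin 2) (Fin 2) ℂ)ˣ) : Matrix (Fin 2) (Fin 2) ℂ)) := by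
    intro v
    rw [← one_mul (_ * pauliY), ← pauliY_mul_self, mul_assoc, ← mul_assoc pauliY _ pauliY,
      ← mul_one (pauliY * _ * pauliY), ← pauliY_mul_self, ← mul_assoc, hadj v]
    simp only [Matrix.smul_mul, mul_assoc, Matrix.mul_smul]
    rw [← mul_assoc pauliY pauliY, pauliY_mul_self]
    simp
  have hdet : (w : Matrix (Fin 2) (Fin 2) ℂ).det
      * ((w⁻¹ : (Matrix (Fin 2) (Fin 2) ℂ)ˣ) : Matrix (Fin 2) (Fin 2) ℂ).det = 1 := by
    rw [← Matrix.det_mul, Units.mul_inv, Matrix.det_one]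
  have hsign : ∀ X : AuxOp N, (-1) ^ N * X = X * (-1) ^ N := fun X =>
    ((Commute.neg_one_left X).pow_left N).eq
  rw [bulkMonodromyHat, map_mul, map_pow, map_neg, map_one, map_mul, map_mul, conjAux_auxOp,
    conjAux_transpose, conjAux_bulkMonodromy, transpose_mul_auxOp, transpose_auxOp_mul,
    ← mul_assoc (auxOp N _), auxOp_mul, hadj, mul_assoc _ _ (auxOp N pauliY),
    mul_assoc _ (auxOp N _) (auxOp N pauliY), auxOp_mul, hadj']
  simp only [inv_inv, auxOp_smul, Matrix.smul_mul, Matrix.mul_smul, smul_smul]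
  rw [mul_comm, hdet, one_smul, ← auxOp_mul, ← auxOp_mul]
  rw [← mul_assoc (auxOp N _) ((-1) ^ N), ← hsign]
  simp only [mul_assoc]

lemma auxOp_mul_conjAux_Uplus {N : ℕ} (w : (Matrix (Fin 2) (Fin 2) ℂ)ˣ) (η : ℂ) (ξ : Fin N → ℂ)
    (bp : Boundary) (u : ℂ) :
    auxOp N w * conjAux (ΓUnit N w) (Uplus η ξ bp u)
        * auxOp N (w⁻¹ : (Matrix (Fin 2) (Fin 2) ℂ)ˣ)
      = ((bulkMonodromy η ξ u)ᵀ * (auxOp N (w * Kplus η bp u * (w⁻¹ : (Matrix (Fin 2) (Fin 2) ℂ)ˣ)))ᵀ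
        * (bulkMonodromyHat η ξ u)ᵀ)ᵀ := by
  apply Matrix.transpose_injective
  have h1 : auxOp N ((w⁻¹ : (Matrix (Fin 2) (Fin 2) ℂ)ˣ) : Matrix (Fin 2) (Fin 2) ℂ)ᵀ
      * auxOp N (w : Matrix (Fin 2) (Fin 2) ℂ)ᵀ = 1 := by
    rw [auxOp_mul, ← Matrix.transpose_mul, Units.mul_inv, Matrix.transpose_one, auxOp_one]
  rw [transpose_mul_auxOp, transpose_auxOp_mul, Uplus, conjAux_transpose, map_mul, map_mul,
    transpose_auxOp, conjAux_auxOp, conjAux_transpose, conjAux_transpose, conjAux_bulkMonodromy,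
    conjAux_bulkMonodromyHat, transpose_mul_auxOp, transpose_mul_auxOp, transpose_auxOp_mul,
    transpose_auxOp_mul, Matrix.transpose_transpose, Matrix.transpose_transpose, transpose_auxOp,
    Matrix.transpose_mul, Matrix.transpose_mul, ← auxOp_mul, ← auxOp_mul]
  simp only [← mul_assoc]
  rw [h1, one_mul, mul_assoc _ (auxOp N _) (auxOp N _), h1, mul_one]

/-- The transformed boundary monodromy matrix is built from the untransformed bulk monodromy matrices
and the transformed scalar matrix `W K₊ W⁻¹`. -/
lemma Ubar_eq {N : ℕ} (η : ℂ) (ξ : Fin N → ℂ) (bp bm : Boundary) (hW : (W bp bm).det ≠ 0) (u : ℂ) :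
    Ubar η ξ bp bm u
      = ((bulkMonodromy η ξ u)ᵀ * (auxOp N (W bp bm * Kplus η bp u * (W bp bm)⁻¹))ᵀ
        * (bulkMonodromyHat η ξ u)ᵀ)ᵀ := by
  have h := auxOp_mul_conjAux_Uplus (N := N)
    ((W bp bm).nonsingInvUnit (isUnit_iff_ne_zero.2 hW)) η ξ bp u
  have hΓ : (Γ N (W bp bm))⁻¹ = Γ N (W bp bm)⁻¹ :=
    Matrix.inv_eq_right_inv (ΓUnit N ((W bp bm).nonsingInvUnit (isUnit_iff_ne_zero.2 hW))).mul_inv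
  rw [conjAux_apply] at h
  rw [Ubar, hΓ]
  exact h

lemma neg_one_pow_mul_eq_smul {N : ℕ} (X : AuxOp N) : (-1) ^ N * X = (-1 : ℂ) ^ N • X := by
  rcases Nat.even_or_odd N with h | h
  · rw [h.neg_one_pow, h.neg_one_pow, one_mul, one_smul]
  · rw [h.neg_one_pow, h.neg_one_pow, neg_one_mul, neg_one_smul]

lemma bulkMonodromyHat_zero {N : ℕ} (η : ℂ) (ξ : Fin N → ℂ) (u : ℂ) :
    bulkMonodromyHat η ξ u 0 0 = (-1 : ℂ) ^ N • bulkD η ξ (-u)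
      ∧ bulkMonodromyHat η ξ u 0 1 = -((-1 : ℂ) ^ N • bulkB η ξ (-u)) := by
  rw [bulkMonodromyHat, neg_one_pow_mul_eq_smul]
  constructor <;>
    simp [auxOp, pauliY, Matrix.mul_apply, Fin.sum_univ_two, Algebra.algebraMap_eq_smul_one,
      smul_smul, bulkD, bulkB]

/-! ### The transformed boundary matrix -/

lemma Boundary.root_sq (b : Boundary) : b.root ^ 2 = 1 + 4 * b.κ ^ 2 := by
  have h : Complex.sqrt (1 + 4 * b.κ ^ 2) ^ 2 = 1 + 4 * b.κ ^ 2 := by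
    rw [Complex.sqrt]
    exact_mod_cast Complex.cpow_nat_inv_pow _ two_ne_zero
  rw [Boundary.root, mul_pow, h]
  rcases Int.units_eq_one_or b.ε with h | h <;> simp [h]

lemma Boundary.inv_ζbar (b : Boundary) : b.ζbar⁻¹ = b.root / b.ζ := by
  rw [Boundary.ζbar, Boundary.root]
  rcases Int.units_eq_one_or b.ε with h | h <;> simp [h, neg_div]

lemma Boundary.root_eq_one (b : Boundary) (h : b.κ = 0 → b.ε = 1) (hκ : b.κ = 0) : b.root = 1 := by
  simp [Boundary.root, h hκ, hκ, Complex.sqrt]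

/-- The second row of `W` is a left eigenvector of `K₊`. -/
lemma W_mul_Kplus_one (η : ℂ) (bp bm : Boundary) (hζ : bp.ζ ≠ 0) (hp : bp.κ = 0 → bp.ε = 1)
    (u : ℂ) (j : Fin 2) : (W bp bm * Kplus η bp u) 1 j
      = (1 - (u + η / 2) * (bp.root / bp.ζ)) * W bp bm 1 j := by
  have hsq := bp.root_sq
  have he := Complex.exp_ne_zero bp.τ
  by_cases hκ : bp.κ = 0
  · have hr := bp.root_eq_one hp hκ
    fin_cases j <;>
      simp [W, Kplus, Boundary.K, Matrix.mul_apply, Fin.sum_univ_two, hκ, hr]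
    field_simp
  · fin_cases j <;>
      simp [W, Kplus, Boundary.K, Matrix.mul_apply, Fin.sum_univ_two, Complex.exp_neg] <;>
      field_simp
    · linear_combination (-(u * 2 + η)) * hsq
    · ring

/-- The entries of `W K₊ W⁻¹`, which is upper triangular; the off-diagonal entry is proportional to
`2λ + η`. -/
lemma W_mul_Kplus_mul_inv (η : ℂ) (bp bm : Boundary) (hζ : bp.ζ ≠ 0) (hp : bp.κ = 0 → bp.ε = 1)
    (hW : (W bp bm).det ≠ 0) (u : ℂ) :
    (W bp bm * Kplus η bp u * (W bp bm)⁻¹) 1 0 = 0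
      ∧ (W bp bm * Kplus η bp u * (W bp bm)⁻¹) 1 1 = 1 - (u + η / 2) * (bp.root / bp.ζ)
      ∧ (W bp bm * Kplus η bp u * (W bp bm)⁻¹) 0 0 = 1 + (u + η / 2) * (bp.root / bp.ζ) := by
  have hrow : ∀ j, (W bp bm * Kplus η bp u * (W bp bm)⁻¹) 1 j
      = (1 - (u + η / 2) * (bp.root / bp.ζ)) * (1 : Matrix (Fin 2) (Fin 2) ℂ) 1 j := by
    intro j
    rw [← Matrix.mul_nonsing_inv (W bp bm) (isUnit_iff_ne_zero.2 hW)]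
    rw [Matrix.mul_apply, Matrix.mul_apply, Finset.mul_sum]
    exact Finset.sum_congr rfl fun k _ => by rw [W_mul_Kplus_one η bp bm hζ hp, mul_assoc]
  have htr : (W bp bm * Kplus η bp u * (W bp bm)⁻¹).trace = 2 := by
    rw [Matrix.trace_mul_comm, ← mul_assoc, Matrix.nonsing_inv_mul _ (isUnit_iff_ne_zero.2 hW),
      one_mul]
    simp [Kplus, Boundary.K, Matrix.trace_fin_two]
    field_simp
    ring
  have h11 := hrow 1
  rw [Matrix.one_apply_eq, mul_one] at h11
  refine ⟨by simpa using hrow 0, h11, ?_⟩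
  rw [Matrix.trace_fin_two, h11] at htr
  linear_combination htr

lemma bbar_eq (η : ℂ) (bp bm : Boundary) (hζ : bp.ζ ≠ 0) (hW : (W bp bm).det ≠ 0) (u : ℂ) :
    bbar η bp bm u = (2 * u + η) * (bbar 0 bp bm 1 / 2) := by
  have h : ∀ η u : ℂ, Kplus η bp u = 1 + (u + η / 2) • ((1 / bp.ζ) •
      !![1, 2 * bp.κ * Complex.exp bp.τ; 2 * bp.κ * Complex.exp (-bp.τ), -1]) := by
    intro η u
    ext i j
    fin_cases i <;> fin_cases j <;> simp [Kplus, Boundary.K] <;> field_simp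
    ring
  have h' : ∀ η u : ℂ, bbar η bp bm u = (u + η / 2) * (W bp bm * ((1 / bp.ζ) •
      !![1, 2 * bp.κ * Complex.exp bp.τ; 2 * bp.κ * Complex.exp (-bp.τ), -1])
        * (W bp bm)⁻¹) 0 1 := by
    intro η u
    rw [bbar, h, mul_add, add_mul, mul_one, Matrix.mul_nonsing_inv _ (isUnit_iff_ne_zero.2 hW),
      Matrix.mul_smul, Matrix.smul_mul, Matrix.add_apply, Matrix.smul_apply, smul_eq_mul,
      Matrix.one_apply_ne (by decide), zero_add]
  rw [h' η u, h' 0 1]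
  ring

lemma transpose_mul_auxOp_mul_apply {N : ℕ} (X Y : AuxOp N) (k : Matrix (Fin 2) (Fin 2) ℂ) :
    (Xᵀ * (auxOp N k)ᵀ * Yᵀ)ᵀ 0 1 = k 0 0 • (X 0 1 * Y 0 0) + k 0 1 • (X 1 1 * Y 0 0)
      + k 1 0 • (X 0 1 * Y 0 1) + k 1 1 • (X 1 1 * Y 0 1) := by
  simp only [Matrix.transpose_apply, Matrix.mul_apply, Fin.sum_univ_two, auxOp, Matrix.map_apply,
    Algebra.algebraMap_eq_smul_one, mul_smul_comm, mul_one, add_mul, smul_mul_assoc]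
  abel

/-- The boundary operator `ℬ̄₊(λ)` with the `D` moved to the right, in the form of `bdyOp`. -/
lemma Bbar_mulVec {N : ℕ} (η : ℂ) (ξ : Fin N → ℂ) (bp bm : Boundary) (hζ : bp.ζ ≠ 0)
    (hroot : 1 + 4 * bp.κ ^ 2 ≠ 0) (hp : bp.κ = 0 → bp.ε = 1) (hW : (W bp bm).det ≠ 0) (u : ℂ)
    (hu : u ≠ 0) (v : Space N) :
    Bbar η ξ bp bm u *ᵥ v = ((-1 : ℂ) ^ N * (2 * u + η)) •
      bdyOp (fun u => (bulkB η ξ u).mulVecLin) (fun u => (bulkD η ξ u).mulVecLin)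
        bp.ζbar⁻¹ (bp.ζbar - η / 2) (bbar 0 bp bm 1 / 2) u v := by
  obtain ⟨h10, h11, h00⟩ := W_mul_Kplus_mul_inv η bp bm hζ hp hW u
  rw [← bp.inv_ζbar] at h11 h00
  have h01 := bbar_eq η bp bm hζ hW u
  rw [bbar] at h01
  have hz : bp.ζbar ≠ 0 := by
    have h : bp.root ≠ 0 := fun h => hroot (by rw [← bp.root_sq, h]; ring)
    intro h0
    have := bp.inv_ζbar
    rw [h0, _root_.inv_zero] at this
    exact div_ne_zero h hζ this.symm
  have huu : u ≠ -u := fun h => hu (by linear_combination h / 2)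
  have hDB := (isExchange_bulk η ξ).exchange u (-u) v huu
  have hDD : bulkD η ξ u * bulkD η ξ (-u) = bulkD η ξ (-u) * bulkD η ξ u :=
    (bulkMonodromy_commute η ξ u (-u) 1 1).eq
  have hB : Bbar η ξ bp bm u = (-1 : ℂ) ^ N •
      ((1 + (u + η / 2) * bp.ζbar⁻¹) • (bulkB η ξ u * bulkD η ξ (-u))
        + ((2 * u + η) * (bbar 0 bp bm 1 / 2)) • (bulkD η ξ (-u) * bulkD η ξ u)
        - (1 - (u + η / 2) * bp.ζbar⁻¹) • (bulkD η ξ u * bulkB η ξ (-u))) := by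
    rw [Bbar, Ubar_eq η ξ bp bm hW u, ← hDD]
    rw [transpose_mul_auxOp_mul_apply, (bulkMonodromyHat_zero η ξ u).1,
      (bulkMonodromyHat_zero η ξ u).2, h10, h11, h00, h01]
    change _ • (bulkB η ξ u * _) + _ • (bulkD η ξ u * _) + _ + _ • (bulkD η ξ u * _) = _
    simp only [mul_neg, mul_smul_comm, zero_smul, add_zero]
    module
  simp only [Matrix.mulVecLin_apply] at hDB
  rw [hB]
  simp only [Matrix.smul_mulVec, Matrix.sub_mulVec, Matrix.add_mulVec, ← Matrix.mulVec_mulVec,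
    hDB, bdyOp, Matrix.mulVecLin_apply, bdyWeight]
  match_scalars <;> field_simp <;> ring

/-! ### Comparison of the two forms of the expansion -/

/-- The state in which the indices in `Y` carry the signs `σ`, and the others are absent. -/
def stateOf {M : ℕ} (Y : Finset (Fin M)) (σ : ↥Y → ℤˣ) : Fin M → Option ℤˣ :=
  fun i => if h : i ∈ Y then some (σ ⟨i, h⟩) else none

lemma sum_state_eq {M : ℕ} {A : Type*} [AddCommMonoid A] (φ : (Fin M → Option ℤˣ) → A) :
    ∑ t, φ t = ∑ Y : Finset (Fin M), ∑ σ : ↥Y → ℤˣ, φ (stateOf Y σ) := by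
  rw [← Fintype.sum_sigma' (fun (Y : Finset (Fin M)) (σ : ↥Y → ℤˣ) => φ (stateOf Y σ))]
  symm
  refine Fintype.sum_bijective (fun p : Σ Y : Finset (Fin M), ↥Y → ℤˣ => stateOf p.1 p.2) ⟨?_, ?_⟩
    _ _ fun _ => rfl
  · rintro ⟨Y, σ⟩ ⟨Z, τ⟩ h
    have hY : Y = Z := by
      ext i
      have := congrFun h i
      by_cases h1 : i ∈ Y <;> by_cases h2 : i ∈ Z <;> simp_all [stateOf]
    subst hY
    congr 1
    ext1 ⟨i, hi⟩
    have := congrFun h i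
    simpa [stateOf, hi] using this
  · intro t
    refine ⟨⟨Finset.univ.filter fun i => (t i).isSome,
      fun i => (t i).get (Finset.mem_filter.1 i.2).2⟩, ?_⟩
    ext1 i
    cases hi : t i <;> simp [stateOf, hi]

lemma absent_stateOf {M : ℕ} (Y : Finset (Fin M)) (σ : ↥Y → ℤˣ) : absent (stateOf Y σ) = Yᶜ := by
  ext i
  simp [absent, stateOf]

/-- A product over pairs, split according to a subset `Y` whose complement contributes nothing by
itself. -/
lemma prod_lt_split {M : ℕ} (Y : Finset (Fin M)) (w : Fin M → Fin M → ℂ)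
    (hw : ∀ i j, w i j = w j i) (h1 : ∀ i ∈ Yᶜ, ∀ j ∈ Yᶜ, w i j = 1) :
    ∏ i, ∏ j, (if i < j then w i j else 1)
      = (∏ i ∈ Yᶜ, ∏ j ∈ Y, w i j) * ∏ i ∈ Y, ∏ j ∈ Y, if i < j then w i j else 1 := by
  have hin : ∀ i, ∏ j, (if i < j then w i j else 1) = (∏ j ∈ Y, if i < j then w i j else 1)
      * ∏ j ∈ Yᶜ, if i < j then w i j else 1 := fun i => (Finset.prod_mul_prod_compl Y _).symm
  have hcc : ∏ i ∈ Yᶜ, ∏ j ∈ Yᶜ, (if i < j then w i j else 1) = 1 :=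
    Finset.prod_eq_one fun i hi => Finset.prod_eq_one fun j hj => by rw [h1 i hi j hj, ite_self]
  have hcy : ∏ i ∈ Yᶜ, ∏ j ∈ Y, w i j = (∏ i ∈ Y, ∏ j ∈ Yᶜ, if i < j then w i j else 1)
      * ∏ i ∈ Yᶜ, ∏ j ∈ Y, if i < j then w i j else 1 := by
    rw [Finset.prod_comm (s := Y), ← Finset.prod_mul_distrib]
    refine Finset.prod_congr rfl fun i hi => ?_
    rw [← Finset.prod_mul_distrib]
    refine Finset.prod_congr rfl fun j hj => ?_
    have hij : i ≠ j := fun h => Finset.mem_compl.1 hi (h ▸ hj)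
    rcases lt_or_gt_of_ne hij with h | h
    · rw [if_neg h.not_gt, if_pos h, one_mul]
    · rw [if_pos h, if_neg h.not_gt, mul_one, hw]
  rw [← Finset.prod_mul_prod_compl Y]
  simp only [hin, Finset.prod_mul_distrib, hcc, hcy]
  ring

/-- The coefficient of a state, with the factors `2λ + η` of the boundary operators restored, is the
coefficient of the corresponding pair of subsets and family of signs. -/
lemma stateCoef_stateOf {N M : ℕ} (η c : ℂ) (ξ : Fin N → ℂ) (bp : Boundary) (l : Fin M → ℂ)
    (β : ℂ → ℂ) (hβ : ∀ u, β u = (2 * u + η) * c) (Y : Finset (Fin M))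
    (σ : ↥Y → ℤˣ) :
    (∏ j, (2 * l j + η)) * (stateCoef η (dFun η ξ) bp.ζbar⁻¹ (bp.ζbar - η / 2) l (stateOf Y σ)
        * c ^ (absent (stateOf Y σ)).card)
      = ((∏ i ∈ Yᶜ, β (l i) * dFun η ξ (l i) * dFun η ξ (-l i))
              / (∏ i ∈ Yᶜ, ∏ j : ↥Y, (l i ^ 2 - l j ^ 2)))
            * (∏ i ∈ Yᶜ, ∏ j : ↥Y, (l i ^ 2 - (sgn (σ j) * l j - η) ^ 2))
            * (H η ξ bp σ (fun j : ↥Y => l j) / bp.ζbar ^ Y.card) := by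
  have hnone : ∀ i ∈ Yᶜ, stateOf Y σ i = none := fun i hi => by
    simp [stateOf, Finset.mem_compl.1 hi]
  have hsome : ∀ j : ↥Y, stateOf Y σ j = some (σ j) := fun j => by simp [stateOf]
  have hpair := prod_lt_split Y
    (fun i j => pairWt η (l i) (l j) (stateOf Y σ i) (stateOf Y σ j))
    (fun i j => pairWt_symm _ _ _ _ _) (fun i hi j hj => by rw [hnone i hi, hnone j hj]; rfl)
  have h1 : ∏ i ∈ Yᶜ, ∏ j ∈ Y, pairWt η (l i) (l j) (stateOf Y σ i) (stateOf Y σ j)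
      = (∏ i ∈ Yᶜ, ∏ j : ↥Y, (l i ^ 2 - (sgn (σ j) * l j - η) ^ 2))
        / (∏ i ∈ Yᶜ, ∏ j : ↥Y, (l i ^ 2 - l j ^ 2)) := by
    rw [← Finset.prod_div_distrib]
    refine Finset.prod_congr rfl fun i hi => ?_
    rw [← Finset.prod_div_distrib, ← Finset.prod_coe_sort]
    refine Finset.prod_congr rfl fun j _ => ?_
    rw [hnone i hi, hsome, pairWt, pairF, sgn_mul_sq]
  have h2 : ∏ i ∈ Y, ∏ j ∈ Y, (if i < j then
        pairWt η (l i) (l j) (stateOf Y σ i) (stateOf Y σ j) else 1)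
      = ∏ r : ↥Y, ∏ s : ↥Y, if r < s then
        (sgn (σ s) * l s + sgn (σ r) * l r - η) / (sgn (σ s) * l s + sgn (σ r) * l r) else 1 := by
    rw [← Finset.prod_coe_sort]
    refine Finset.prod_congr rfl fun r _ => ?_
    rw [← Finset.prod_coe_sort]
    refine Finset.prod_congr rfl fun s _ => ?_
    rw [hsome, hsome, pairWt]
    rfl
  have h3 : (∏ j, (2 * l j + η)) * (∏ i, siteWt (dFun η ξ) bp.ζbar⁻¹ (bp.ζbar - η / 2) (l i)
        (stateOf Y σ i)) * c ^ (absent (stateOf Y σ)).card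
      = (∏ i ∈ Yᶜ, β (l i) * dFun η ξ (l i) * dFun η ξ (-l i))
        * ((∏ j : ↥Y, dFun η ξ (-(sgn (σ j) * l j)) * ((2 * l j + η) / (2 * l j))
          * (l j + sgn (σ j) * (bp.ζbar - η / 2))) / bp.ζbar ^ Y.card) := by
    rw [absent_stateOf, ← Finset.prod_mul_distrib, ← Finset.prod_mul_prod_compl Y]
    have e1 : ∏ i ∈ Yᶜ, (2 * l i + η) * siteWt (dFun η ξ) bp.ζbar⁻¹ (bp.ζbar - η / 2) (l i)
        (stateOf Y σ i) * c = ∏ i ∈ Yᶜ, β (l i) * dFun η ξ (l i) * dFun η ξ (-l i) := by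
      refine Finset.prod_congr rfl fun i hi => ?_
      rw [hnone i hi, hβ, siteWt, Option.elim_none]
      ring
    rw [Finset.prod_mul_distrib (f := fun i => _ * _), Finset.prod_const] at e1
    have e2 : ∏ i ∈ Y, (2 * l i + η) * siteWt (dFun η ξ) bp.ζbar⁻¹ (bp.ζbar - η / 2) (l i)
        (stateOf Y σ i) = (∏ j : ↥Y, dFun η ξ (-(sgn (σ j) * l j)) * ((2 * l j + η) / (2 * l j))
          * (l j + sgn (σ j) * (bp.ζbar - η / 2))) / bp.ζbar ^ Y.card := by
      rw [← Finset.prod_coe_sort, ← Finset.prod_const, ← Finset.prod_coe_sort Y fun _ => bp.ζbar,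
        ← Finset.prod_div_distrib]
      refine Finset.prod_congr rfl fun j _ => ?_
      rw [hsome, siteWt, Option.elim_some, bdyWeight]
      rcases sgn_eq (σ j) with h | h <;> rw [h] <;> simp only [div_eq_mul_inv, mul_inv] <;> ring
    rw [e2, mul_assoc, e1]
    ring
  rw [stateCoef, hpair, h1, h2, H]
  linear_combination ((∏ i ∈ Yᶜ, ∏ j : ↥Y, (l i ^ 2 - (sgn (σ j) * l j - η) ^ 2))
        / (∏ i ∈ Yᶜ, ∏ j : ↥Y, (l i ^ 2 - l j ^ 2))) * (∏ r : ↥Y, ∏ s : ↥Y, if r < s then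
        (sgn (σ s) * l s + sgn (σ r) * l r - η) / (sgn (σ s) * l s + sgn (σ r) * l r) else 1) * h3

lemma sort_univ_eq_filterMap {M : ℕ} (Y : Finset (Fin M)) :
    (Finset.univ : Finset ↥Y).sort (· ≤ ·)
      = (List.finRange M).filterMap fun i => if h : i ∈ Y then some (⟨i, h⟩ : ↥Y) else none := by
  refine (Finset.sortedLT_sort _).eq_of_mem_iff (List.Pairwise.sortedLT ?_) fun a => ?_
  · rw [List.pairwise_filterMap]
    refine (List.pairwise_lt_finRange M).imp fun {i j} hij a ha b hb => ?_
    simp only [Option.dite_none_right_eq_some, Option.some.injEq] at ha hb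
    obtain ⟨_, rfl⟩ := ha
    obtain ⟨_, rfl⟩ := hb
    exact hij
  · simp

lemma orderedProd_mulVec {N : ℕ} {ι : Type} [Fintype ι] [LinearOrder ι] (f : ι → Op N)
    (v : Space N) :
    orderedProd f *ᵥ v = ((Finset.univ : Finset ι).sort (· ≤ ·)).foldr (fun i w => f i *ᵥ w) v := by
  rw [orderedProd]
  induction (Finset.univ : Finset ι).sort (· ≤ ·) with
  | nil => simp
  | cons i L ih => rw [List.map_cons, List.prod_cons, ← Matrix.mulVec_mulVec, ih, List.foldr_cons]

lemma orderedProd_bulkB_mulVec_vac {N M : ℕ} (η : ℂ) (ξ : Fin N → ℂ) (l : Fin M → ℂ)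
    (Y : Finset (Fin M)) (σ : ↥Y → ℤˣ) :
    (orderedProd fun j : ↥Y => bulkB η ξ (sgn (σ j) * l j)) *ᵥ vac N
      = bulkState (fun u => (bulkB η ξ u).mulVecLin) (vac N) (points l (stateOf Y σ)) := by
  rw [orderedProd_mulVec, sort_univ_eq_filterMap, List.foldr_filterMap, bulkState,
    List.ofFn_eq_map, List.foldr_map]
  congr 1
  ext1 i
  ext1 w
  by_cases h : i ∈ Y <;> simp [points, stateOf, h]

end OpenXXX

end

theorem mainTheorem2 (N M : ℕ) (η : ℂ) (ξ : Fin N → ℂ) (bp bm : OpenXXX.Boundary)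
    (hζ : bp.ζ ≠ 0) (hroot : 1 + 4 * bp.κ ^ 2 ≠ 0)
    (hp : bp.κ = 0 → bp.ε = 1) (hm : bm.κ = 0 → bm.ε = 1)
    (hW : (OpenXXX.W bp bm).det ≠ 0)
    (l : Fin M → ℂ) (hl : ∀ j, l j ≠ 0) (hll : ∀ i j, i ≠ j → l i ^ 2 ≠ l j ^ 2) :
    (OpenXXX.orderedProd fun j => OpenXXX.Bbar η ξ bp bm (l j)) *ᵥ OpenXXX.vac N
      = (-1 : ℂ) ^ (N * M) •
        ∑ Y : Finset (Fin M), ∑ σ : ↥Y → ℤˣ,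
          (((∏ i ∈ Yᶜ, OpenXXX.bbar η bp bm (l i)
                * OpenXXX.dFun η ξ (l i) * OpenXXX.dFun η ξ (-l i))
              / (∏ i ∈ Yᶜ, ∏ j : ↥Y, (l i ^ 2 - l j ^ 2)))
            * (∏ i ∈ Yᶜ, ∏ j : ↥Y, (l i ^ 2 - (OpenXXX.sgn (σ j) * l j - η) ^ 2))
            * (OpenXXX.H η ξ bp σ (fun j : ↥Y => l j) / bp.ζbar ^ Y.card)) •
          ((OpenXXX.orderedProd fun j : ↥Y => OpenXXX.bulkB η ξ (OpenXXX.sgn (σ j) * l j))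
            *ᵥ OpenXXX.vac N) := by
  open OpenXXX in
  have hfold : ∀ L : List ℂ, (∀ u ∈ L, u ≠ 0) →
      L.foldr (fun u w => Bbar η ξ bp bm u *ᵥ w) (vac N)
      = (L.map fun u => (-1 : ℂ) ^ N * (2 * u + η)).prod •
        L.foldr (bdyOp (fun u => (bulkB η ξ u).mulVecLin) (fun u => (bulkD η ξ u).mulVecLin)
          bp.ζbar⁻¹ (bp.ζbar - η / 2) (bbar 0 bp bm 1 / 2)) (vac N) := by
    intro L hL
    induction L with
    | nil => simp
    | cons u L ih =>
      rw [List.foldr_cons, List.foldr_cons, ih fun v hv => hL v (List.mem_cons_of_mem _ hv),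
        Matrix.mulVec_smul, Bbar_mulVec η ξ bp bm hζ hroot hp hW u (hL u List.mem_cons_self),
        smul_smul, List.map_cons, List.prod_cons, mul_comm]
  have h := hfold (List.ofFn l) (by simpa [List.mem_ofFn] using hl)
  rw [(OpenXXX.isExchange_bulk η ξ).foldr_bdyOp _ _ _ l hl hll, OpenXXX.sum_state_eq,
    List.map_ofFn, List.prod_ofFn] at h
  simp only [Function.comp_apply, Finset.prod_mul_distrib, Finset.prod_const, Finset.card_univ,
    Fintype.card_fin, ← pow_mul] at h
  rw [OpenXXX.orderedProd_mulVec, Fin.sort_univ]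
  rw [List.ofFn_eq_map, List.foldr_map] at h
  rw [h, mul_smul, Finset.smul_sum]
  congr 1
  refine Finset.sum_congr rfl fun Y _ => ?_
  rw [Finset.smul_sum]
  refine Finset.sum_congr rfl fun σ _ => ?_
  rw [smul_smul, OpenXXX.stateCoef_stateOf η _ ξ bp l _ (OpenXXX.bbar_eq η bp bm hζ hW) Y σ,
    OpenXXX.orderedProd_bulkB_mulVec_vac]
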